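/- Let $\mathscr{C}$ be either the category of Banach Abelian groups (Abelian groups with a complete norm) and bounded homomorphisms, or its full subcategory of non-Archimedean (ultrametric) ones. Let $R$ be a commutative unital Banach ring in $\mathscr{C}$, i.e. a commutative ring with a complete norm (ultrametric in the second case) such that $\|ab\| \le C\|a\|\,\|b\|$ for some constant $C$. Let $\mathrm{Mod}_{\mathscr{C}}(R)$ be the category of Banach $R$-modules in $\mathscr{C}$ and bounded $R$-linear maps, $\mathrm{Alg}_{\mathscr{C}}(R)$ the category of commutative Banach $R$-algebras in $\mathscr{C}$ and bounded $R$-algebra homomorphisms, $\widehat\otimes_R$ the completed tensor product and $\widehat\otimes_R^{\mathbb L}$ its left derived functor, computed by projective resolutions (projective means: lifting along strict epimorphisms). A morphism is strict if its coimage maps isomorphically to its image; a sequence $X \xrightarrow{f} Y \xrightarrow{g} Z$ is strictly exact at $Y$ if $\mathrm{im} f = \ker g$ and $f$ is strict. A morphism $R \to B$ of Banach rings is a homotopy epimorphism if the multiplication $B \widehat\otimes_R^{\mathbb L} B \to B$ is an isomorphism in the bounded above derived category of $\mathrm{Mod}_{\mathscr{C}}(R)$, i.e. is represented by a quasi-isomorphism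 (a chain map with strictly exact mapping cone). A set $S$ of objects of $\mathrm{Alg}_{\mathscr{C}}(R)$ is a derived (resp. non-derived) cover of $R$ if $R \to B$ is a homotopy epimorphism (resp. an epimorphism in $\mathrm{Alg}_{\mathscr{C}}(R)$) for every $B \in S$, and there are finitely many distinct $B_1, \dots, B_m \in S$ such that the total complex of the derived Tate–Čech complex $$0 \to R \to \prod_{i} B_i \to \prod_{i<j} B_i \widehat\otimes_R^{\mathbb L} B_j \to \prod_{i<j<k} B_i \widehat\otimes_R^{\mathbb L} B_j \widehat\otimes_R^{\mathbb L} B_k \to \cdots$$ (resp. the complex with the same shape with $\widehat\otimes_R$ in place of $\widehat\otimes_R^{\mathbb L}$) is strictly exact. 1. For every idempotent $e \in R$, the ideal $eR$ is closed, $R/eR$ (with the quotient norm) is a projective object of $\mathrm{Mod}_{\mathscr{C}}(R)$, and the quotient map $R \to R/eR$ is a homotopy epimorphism. 2. Let $E \subset R$ be a finite set of pairwise orthogonal idempotents with $\sum_{e \in E} e = 1$. If $E \ne \{1\}$ or $R = 0$, then $\{R/eR \mid e \in E\}$ is both a derived and a non-derived cover of $R$. Moreover, without any restriction on $E$, the set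 $\{R/(1-e)R \mid e \in E\}$, which corresponds to the disjoint clopen cover given by $E$, is both a derived and a non-derived cover of $R$. -/

import Mathlib

open scoped TensorProduct

universe u

/-- The two ambient categories: `arch` is the category of all Banach Abelian groups, `nonarch` the
full subcategory of the non-Archimedean (ultrametric) ones; morphisms are the bounded
homomorphisms. -/
inductive BanachKind where
  | arch
  | nonarch

/-- A commutative Banach ring: a commutative unital ring with a complete norm whose multiplication
is bounded. Neither submultiplicativity nor `‖1‖ = 1` is assumed. -/
class BanachRing (R : Type u) extends CommRing R, Norm R, MetricSpace R where
  dist_eq_norm_sub : ∀ x y : R, dist x y = ‖x - y‖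
  complete : CompleteSpace R
  exists_mul_bound : ∃ C : ℝ, ∀ a b : R, ‖a * b‖ ≤ C * ‖a‖ * ‖b‖

instance BanachRing.toNormedAddCommGroup (R : Type u) [h : BanachRing R] :
    NormedAddCommGroup R where
  __ := h
  dist_eq x y := by rw [dist_comm, BanachRing.dist_eq_norm_sub, sub_eq_neg_add]

instance BanachRing.instCompleteSpace (R : Type u) [BanachRing R] : CompleteSpace R :=
  BanachRing.complete

/-- `M` is an object of the ambient category `𝒞`. -/
class IsOfKind (𝒞 : BanachKind) (M : Type u) [NormedAddCommGroup M] : Prop where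
  ultra : 𝒞 = BanachKind.nonarch → IsUltrametricDist M

/-- Objects of `Mod_𝒞(A)`: Banach `A`-modules (ultrametric ones if `𝒞 = nonarch`). -/
structure BanMod (𝒞 : BanachKind) (A : Type u) [BanachRing A] where
  carrier : Type u
  [normed : NormedAddCommGroup carrier]
  [module : Module A carrier]
  [complete : CompleteSpace carrier]
  [kind : IsOfKind 𝒞 carrier]
  exists_smul_bound : ∃ C : ℝ, ∀ (a : A) (m : carrier), ‖a • m‖ ≤ C * ‖a‖ * ‖m‖

namespace BanMod

variable {𝒞 : BanachKind} {A : Type u} [BanachRing A]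

instance : CoeSort (BanMod 𝒞 A) (Type u) := ⟨BanMod.carrier⟩

attribute [instance] BanMod.normed BanMod.module BanMod.complete BanMod.kind

end BanMod

/-- Morphisms of `Mod_𝒞(A)`: bounded `A`-linear maps. -/
structure BanHom {𝒞 : BanachKind} {A : Type u} [BanachRing A] (M N : BanMod 𝒞 A)
    extends M →ₗ[A] N where
  exists_bound : ∃ C : ℝ, ∀ x, ‖toFun x‖ ≤ C * ‖x‖

namespace BanHom

variable {𝒞 : BanachKind} {A : Type u} [BanachRing A] {M N T : BanMod 𝒞 A}

instance : FunLike (BanHom M N) M N where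
  coe f := f.toFun
  coe_injective f g h := by
    cases f; cases g; congr; exact DFunLike.coe_injective h

instance : LinearMapClass (BanHom M N) A M N where
  map_add f := f.map_add
  map_smulₛₗ f := f.map_smul

theorem bound (f : BanHom M N) : ∃ C : ℝ, 0 ≤ C ∧ ∀ x, ‖f x‖ ≤ C * ‖x‖ := by
  obtain ⟨C, hC⟩ := f.exists_bound
  exact ⟨max C 0, le_max_right _ _, fun x => (hC x).trans (by gcongr; exact le_max_left _ _)⟩

/-- The identity morphism. -/
def id (M : BanMod 𝒞 A) : BanHom M M where
  toLinearMap := LinearMap.id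
  exists_bound := ⟨1, fun x => by simp⟩

/-- Composition of morphisms. -/
def comp (g : BanHom N T) (f : BanHom M N) : BanHom M T where
  toLinearMap := g.toLinearMap ∘ₗ f.toLinearMap
  exists_bound := by
    obtain ⟨C, hC, hf⟩ := f.bound
    obtain ⟨D, hD, hg⟩ := g.bound
    refine ⟨D * C, fun x => (hg _).trans ?_⟩
    rw [mul_assoc]
    exact mul_le_mul_of_nonneg_left (hf x) hD

/-- The sum of two morphisms. -/
instance : Add (BanHom M N) where
  add f g :=
    { toLinearMap := f.toLinearMap + g.toLinearMap
      exists_bound := by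
        obtain ⟨C, hC, hf⟩ := f.bound
        obtain ⟨D, hD, hg⟩ := g.bound
        refine ⟨C + D, fun x => (norm_add_le _ _).trans ?_⟩
        rw [add_mul]
        exact add_le_add (hf x) (hg x) }

/-- The zero morphism. -/
instance : Zero (BanHom M N) where
  zero :=
    { toLinearMap := 0
      exists_bound := ⟨0, fun x => by simp⟩ }

/-- The opposite of a morphism. -/
instance : Neg (BanHom M N) where
  neg f :=
    { toLinearMap := -f.toLinearMap
      exists_bound := by
        obtain ⟨C, hC⟩ := f.exists_bound
        exact ⟨C, fun x => (norm_neg _).trans_le (hC x)⟩ }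

theorem add_apply (f g : BanHom M N) (x : M) : (f + g) x = f x + g x := rfl

theorem zero_apply (x : M) : (0 : BanHom M N) x = 0 := rfl

theorem neg_apply (f : BanHom M N) (x : M) : (-f) x = -f x := rfl

instance : AddCommGroup (BanHom M N) where
  add_assoc f g h := DFunLike.ext _ _ fun x => add_assoc (f x) (g x) (h x)
  zero_add f := DFunLike.ext _ _ fun x => zero_add (f x)
  add_zero f := DFunLike.ext _ _ fun x => add_zero (f x)
  nsmul := nsmulRec
  zsmul := zsmulRec
  neg_add_cancel f := DFunLike.ext _ _ fun x => neg_add_cancel (f x)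
  add_comm f g := DFunLike.ext _ _ fun x => add_comm (f x) (g x)

theorem zsmul_apply (k : ℤ) (f : BanHom M N) (x : M) : (k • f) x = k • f x :=
  map_zsmul (⟨⟨fun f : BanHom M N => f x, rfl⟩, fun _ _ => rfl⟩ : BanHom M N →+ N) k f

theorem sum_apply {ι : Type*} (s : Finset ι) (f : ι → BanHom M N) (x : M) :
    (∑ i ∈ s, f i) x = ∑ i ∈ s, f i x :=
  map_sum (⟨⟨fun f : BanHom M N => f x, rfl⟩, fun _ _ => rfl⟩ : BanHom M N →+ N) f s

theorem comp_apply (g : BanHom N T) (f : BanHom M N) (x : M) : (g.comp f) x = g (f x) := rfl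

theorem id_apply (x : M) : (BanHom.id M) x = x := rfl

theorem comp_assoc {U : BanMod 𝒞 A} (h : BanHom T U) (g : BanHom N T) (f : BanHom M N) :
    (h.comp g).comp f = h.comp (g.comp f) := rfl

theorem id_comp (f : BanHom M N) : (BanHom.id N).comp f = f := rfl

theorem comp_id (f : BanHom M N) : f.comp (BanHom.id M) = f := rfl

theorem zero_comp (f : BanHom M N) : (0 : BanHom N T).comp f = 0 := rfl

theorem comp_add (g : BanHom N T) (f f' : BanHom M N) :
    g.comp (f + f') = g.comp f + g.comp f' :=
  DFunLike.ext _ _ fun x => map_add g (f x) (f' x)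

theorem comp_zsmul (g : BanHom N T) (k : ℤ) (f : BanHom M N) :
    g.comp (k • f) = k • g.comp f :=
  DFunLike.ext _ _ fun x => by
    rw [comp_apply, zsmul_apply, zsmul_apply, map_zsmul, comp_apply]

theorem add_comp (g g' : BanHom N T) (f : BanHom M N) :
    (g + g').comp f = g.comp f + g'.comp f := rfl

theorem zsmul_comp (k : ℤ) (g : BanHom N T) (f : BanHom M N) :
    (k • g).comp f = k • g.comp f :=
  DFunLike.ext _ _ fun x => by
    rw [comp_apply, zsmul_apply, zsmul_apply, comp_apply]

/-- `f` is strict, i.e. the canonical map from the coimage `M / ker f` to the image (the closure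
of the range) is an isomorphism: it is onto, and its inverse is bounded. -/
def IsStrict (f : BanHom M N) : Prop :=
  IsClosed (Set.range f) ∧ ∃ C : ℝ, ∀ x : M, ∃ x' : M, f x' = f x ∧ ‖x'‖ ≤ C * ‖f x‖

end BanHom

/-- The sequence `f`, `g` is strictly exact at the middle term: the image of `f` (the closure of its
range) is the kernel of `g`, and `f` is strict. -/
def StrictExactAt {𝒞 : BanachKind} {A : Type u} [BanachRing A] {M N T : BanMod 𝒞 A}
    (f : BanHom M N) (g : BanHom N T) : Prop :=
  closure (Set.range f) = {y | g y = 0} ∧ f.IsStrict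

namespace BanMod

variable {𝒞 : BanachKind} {A : Type u} [BanachRing A]

/-- The regular module. -/
def regular (𝒞 : BanachKind) (A : Type u) [BanachRing A] [IsOfKind 𝒞 A] : BanMod 𝒞 A where
  carrier := A
  exists_smul_bound := BanachRing.exists_mul_bound

/-- The zero module. -/
def zero (𝒞 : BanachKind) (A : Type u) [BanachRing A] : BanMod 𝒞 A where
  carrier := PUnit
  kind := ⟨fun _ => ⟨fun x y z => by simp⟩⟩
  exists_smul_bound := ⟨0, fun a m => by simp⟩

/-- `M` is projective: every morphism from `M` lifts along every strict epimorphism. A morphism is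
an epimorphism when its range is dense. -/
def IsProjective (M : BanMod 𝒞 A) : Prop :=
  ∀ (N T : BanMod 𝒞 A) (p : BanHom N T), DenseRange p → p.IsStrict →
    ∀ f : BanHom M T, ∃ g : BanHom M N, p.comp g = f

theorem smul_bound (M : BanMod 𝒞 A) : ∃ C : ℝ, 0 ≤ C ∧ ∀ (a : A) (m : M),
    ‖a • m‖ ≤ C * ‖a‖ * ‖m‖ := by
  obtain ⟨C, hC⟩ := M.exists_smul_bound
  refine ⟨max C 0, le_max_right _ _, fun a x => (hC a x).trans ?_⟩
  gcongr
  exact le_max_left _ _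

/-! ### Finite products -/

/-- The product of a finite family, with the supremum norm. -/
noncomputable def pi {ι : Type} [Finite ι] (M : ι → BanMod 𝒞 A) : BanMod 𝒞 A :=
  letI := Fintype.ofFinite ι
  { carrier := ∀ i, M i
    kind := ⟨fun h => by
      have : ∀ i, IsUltrametricDist (M i) := fun i => (M i).kind.ultra h
      infer_instance⟩
    exists_smul_bound := by
      choose C hC0 hC using fun i => (M i).smul_bound
      refine ⟨∑ i, C i, fun a m => ?_⟩
      rw [pi_norm_le_iff_of_nonneg (by
        have := Finset.sum_nonneg fun i (_ : i ∈ Finset.univ) => hC0 i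
        positivity)]
      intro i
      refine (hC i a (m i)).trans ?_
      have h1 : C i ≤ ∑ i, C i :=
        Finset.single_le_sum (f := C) (fun i _ => hC0 i) (Finset.mem_univ i)
      have h2 : ‖m i‖ ≤ ‖m‖ := norm_le_pi_norm m i
      have h3 := hC0 i
      have h4 : 0 ≤ ∑ i, C i := h3.trans h1
      gcongr }

/-- The projection of a finite product to a factor. -/
noncomputable def proj {ι : Type} [Finite ι] (M : ι → BanMod 𝒞 A) (i : ι) :
    BanHom (pi M) (M i) where
  toFun x := x i
  map_add' _ _ := rfl
  map_smul' _ _ := rfl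
  exists_bound := ⟨1, fun x => by
    let _ := Fintype.ofFinite ι
    rw [one_mul]
    exact norm_le_pi_norm (G := fun i => M i) x i⟩

/-- The morphism to a finite product with given components. -/
noncomputable def piLift {ι : Type} [Finite ι] {N : BanMod 𝒞 A} {M : ι → BanMod 𝒞 A}
    (f : ∀ i, BanHom N (M i)) : BanHom N (pi M) where
  toFun x i := f i x
  map_add' x y := funext fun i => map_add (f i) x y
  map_smul' a x := funext fun i => map_smul (f i) a x
  exists_bound := by
    let _ := Fintype.ofFinite ι
    choose C hC0 hC using fun i => (f i).bound
    refine ⟨∑ i, C i, fun x => ?_⟩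
    refine (pi_norm_le_iff_of_nonneg (G := fun i => M i) (by
        have := Finset.sum_nonneg fun i (_ : i ∈ Finset.univ) => hC0 i
        positivity)).2 fun i => (hC i x).trans ?_
    have h1 : C i ≤ ∑ i, C i :=
      Finset.single_le_sum (f := C) (fun i _ => hC0 i) (Finset.mem_univ i)
    gcongr

theorem proj_comp_piLift {ι : Type} [Finite ι] {N : BanMod 𝒞 A} {M : ι → BanMod 𝒞 A}
    (f : ∀ i, BanHom N (M i)) (i : ι) : (proj M i).comp (piLift f) = f i := rfl

theorem pi_hom_ext {ι : Type} [Finite ι] {N : BanMod 𝒞 A} {M : ι → BanMod 𝒞 A}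
    {f g : BanHom N (pi M)} (h : ∀ i, (proj M i).comp f = (proj M i).comp g) : f = g :=
  DFunLike.ext _ _ fun x => funext fun i => DFunLike.congr_fun (h i) x

end BanMod

/-! ### Completed tensor products -/

section Tensor

variable {𝒞 : BanachKind} {A : Type u} [BanachRing A]

/-- The cost of a finite family of pairs `(m, n)`: the sum (`arch`) or the maximum (`nonarch`) of
the numbers `‖m‖ * ‖n‖`. -/
noncomputable def tensorCost (𝒞 : BanachKind) {M N : Type u} [Norm M] [Norm N] :
    List (M × N) → ℝ
  | [] => 0
  | p :: l =>
    match 𝒞 with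
    | .arch => ‖p.1‖ * ‖p.2‖ + tensorCost .arch l
    | .nonarch => max (‖p.1‖ * ‖p.2‖) (tensorCost .nonarch l)

/-- The element `∑ m ⊗ n` represented by a finite family of pairs `(m, n)`. -/
def tensorEval {M N : BanMod 𝒞 A} (l : List (M × N)) : M ⊗[A] N :=
  (l.map fun p => p.1 ⊗ₜ[A] p.2).sum

/-- The tensor seminorm: the infimum of the costs of all representations. -/
noncomputable def tensorNorm {M N : BanMod 𝒞 A} (t : M ⊗[A] N) : ℝ :=
  sInf {c | ∃ l : List (M × N), tensorEval l = t ∧ tensorCost 𝒞 l = c}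

theorem tensorCost_nonneg {M N : Type u} [NormedAddCommGroup M] [NormedAddCommGroup N]
    (l : List (M × N)) : 0 ≤ tensorCost 𝒞 l := by
  induction l with
  | nil => cases 𝒞 <;> simp [tensorCost]
  | cons p l ih =>
    cases 𝒞
    · simp only [tensorCost]; positivity
    · simp only [tensorCost]; exact le_max_of_le_right ih

theorem tensorCost_append_le {M N : Type u} [NormedAddCommGroup M] [NormedAddCommGroup N]
    (l l' : List (M × N)) : tensorCost 𝒞 (l ++ l') ≤ tensorCost 𝒞 l + tensorCost 𝒞 l' := by
  induction l with
  | nil => cases 𝒞 <;> simp [tensorCost]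
  | cons p l ih =>
    cases 𝒞
    · simp only [tensorCost, List.cons_append]; linarith
    · simp only [tensorCost, List.cons_append]
      have h0 := tensorCost_nonneg (𝒞 := .nonarch) l'
      refine max_le ?_ (ih.trans ?_)
      · linarith [le_max_left (‖p.1‖ * ‖p.2‖) (tensorCost .nonarch l)]
      · linarith [le_max_right (‖p.1‖ * ‖p.2‖) (tensorCost .nonarch l)]

theorem tensorCost_append_le_max (h : 𝒞 = .nonarch) {M N : Type u} [NormedAddCommGroup M]
    [NormedAddCommGroup N] (l l' : List (M × N)) :
    tensorCost 𝒞 (l ++ l') ≤ max (tensorCost 𝒞 l) (tensorCost 𝒞 l') := by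
  subst h
  induction l with
  | nil => simp [tensorCost]
  | cons p l ih =>
    simp only [tensorCost, List.cons_append, max_assoc]
    exact max_le_max le_rfl ih

/-- If `‖φ p‖ ≤ C * ‖p.1‖ * ‖p.2‖` for all pairs, with values in a group of the right kind, then
the norm of the sum is at most `C` times the cost. -/
theorem norm_sum_le_tensorCost {M N T : Type u} [NormedAddCommGroup M] [NormedAddCommGroup N]
    [NormedAddCommGroup T] [hT : IsOfKind 𝒞 T] (φ : M × N → T) {C : ℝ} (hC : 0 ≤ C)
    (hφ : ∀ p, ‖φ p‖ ≤ C * (‖p.1‖ * ‖p.2‖)) (l : List (M × N)) :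
    ‖(l.map φ).sum‖ ≤ C * tensorCost 𝒞 l := by
  induction l with
  | nil => cases 𝒞 <;> simp [tensorCost]
  | cons p l ih =>
    rw [List.map_cons, List.sum_cons]
    cases 𝒞
    · simp only [tensorCost, mul_add]
      exact (norm_add_le _ _).trans (add_le_add (hφ p) ih)
    · have := hT.ultra rfl
      simp only [tensorCost, mul_max_of_nonneg _ _ hC]
      exact (IsUltrametricDist.norm_add_le_max _ _).trans (max_le_max (hφ p) ih)

variable {M N T : BanMod 𝒞 A}

theorem tensorEval_append (l l' : List (M × N)) :
    tensorEval (l ++ l') = tensorEval l + tensorEval l' := by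
  simp [tensorEval]

theorem exists_tensorEval (t : M ⊗[A] N) : ∃ l : List (M × N), tensorEval l = t := by
  induction t with
  | zero => exact ⟨[], by simp [tensorEval]⟩
  | tmul m n => exact ⟨[(m, n)], by simp [tensorEval]⟩
  | add x y hx hy =>
    obtain ⟨l, rfl⟩ := hx
    obtain ⟨l', rfl⟩ := hy
    exact ⟨l ++ l', tensorEval_append l l'⟩

theorem tensorNorm_le (l : List (M × N)) : tensorNorm (tensorEval l) ≤ tensorCost 𝒞 l :=
  csInf_le ⟨0, by rintro _ ⟨l, -, rfl⟩; exact tensorCost_nonneg l⟩ ⟨l, rfl, rfl⟩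

theorem le_tensorNorm {t : M ⊗[A] N} {c : ℝ}
    (h : ∀ l : List (M × N), tensorEval l = t → c ≤ tensorCost 𝒞 l) : c ≤ tensorNorm t := by
  obtain ⟨l, hl⟩ := exists_tensorEval t
  refine le_csInf ⟨_, l, hl, rfl⟩ ?_
  rintro _ ⟨l, hl, rfl⟩
  exact h l hl

theorem exists_tensorCost_lt (t : M ⊗[A] N) {c : ℝ} (h : tensorNorm t < c) :
    ∃ l : List (M × N), tensorEval l = t ∧ tensorCost 𝒞 l < c := by
  by_contra! hc
  exact absurd (le_tensorNorm hc) (not_le.2 h)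

theorem tensorNorm_nonneg (t : M ⊗[A] N) : 0 ≤ tensorNorm t :=
  le_tensorNorm fun l _ => tensorCost_nonneg l

theorem tensorNorm_zero : tensorNorm (0 : M ⊗[A] N) = 0 := by
  refine le_antisymm ?_ (tensorNorm_nonneg _)
  have h := tensorNorm_le (𝒞 := 𝒞) (M := M) (N := N) []
  have h0 : tensorCost 𝒞 ([] : List (M × N)) = 0 := by cases 𝒞 <;> rfl
  rw [h0] at h
  simpa [tensorEval] using h

theorem tensorNorm_add_le (s t : M ⊗[A] N) :
    tensorNorm (s + t) ≤ tensorNorm s + tensorNorm t := by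
  refine le_of_forall_pos_le_add fun ε hε => ?_
  obtain ⟨l, rfl, hl⟩ := exists_tensorCost_lt s (c := tensorNorm s + ε / 2) (by linarith)
  obtain ⟨l', rfl, hl'⟩ := exists_tensorCost_lt t (c := tensorNorm t + ε / 2) (by linarith)
  rw [← tensorEval_append]
  refine (tensorNorm_le _).trans ((tensorCost_append_le l l').trans ?_)
  linarith

theorem tensorNorm_add_le_max (h : 𝒞 = .nonarch) (s t : M ⊗[A] N) :
    tensorNorm (s + t) ≤ max (tensorNorm s) (tensorNorm t) := by
  refine le_of_forall_pos_le_add fun ε hε => ?_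
  obtain ⟨l, rfl, hl⟩ := exists_tensorCost_lt s (c := tensorNorm s + ε) (by linarith)
  obtain ⟨l', rfl, hl'⟩ := exists_tensorCost_lt t (c := tensorNorm t + ε) (by linarith)
  rw [← tensorEval_append, ← max_add_add_right]
  exact (tensorNorm_le _).trans ((tensorCost_append_le_max h l l').trans (max_le_max hl.le hl'.le))

/-- A linear map out of the algebraic tensor product which is bounded on pure tensors is bounded
for the tensor seminorm. -/
theorem norm_le_tensorNorm {T : Type u} [NormedAddCommGroup T] [IsOfKind 𝒞 T]
    (f : M ⊗[A] N →+ T) {C : ℝ} (hC : 0 ≤ C)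
    (hf : ∀ m n, ‖f (m ⊗ₜ n)‖ ≤ C * (‖m‖ * ‖n‖)) (t : M ⊗[A] N) : ‖f t‖ ≤ C * tensorNorm t := by
  refine le_of_forall_pos_le_add fun ε hε => ?_
  obtain ⟨l, rfl, hl⟩ := exists_tensorCost_lt t (c := tensorNorm t + ε / (C + 1))
    (lt_add_of_pos_right _ (by positivity))
  have h1 : f (tensorEval l) = (l.map fun p => f (p.1 ⊗ₜ p.2)).sum := by
    rw [tensorEval, map_list_sum, List.map_map]; rfl
  have h2 := norm_sum_le_tensorCost (𝒞 := 𝒞) (fun p : M × N => f (p.1 ⊗ₜ p.2)) hC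
    (fun p => hf p.1 p.2) l
  have h3 : C * (ε / (C + 1)) ≤ ε := by
    rw [mul_div_assoc', div_le_iff₀ (by positivity)]; nlinarith
  have h4 := mul_le_mul_of_nonneg_left hl.le hC
  rw [h1]
  refine h2.trans (h4.trans ?_)
  rw [mul_add]
  linarith

theorem tensorNorm_smul_le_of (g : M ⊗[A] N →+ M ⊗[A] N) (φ : M × N → M × N)
    (hg : ∀ p : M × N, g (p.1 ⊗ₜ p.2) = (φ p).1 ⊗ₜ (φ p).2) {C : ℝ} (hC : 0 ≤ C)
    (hφ : ∀ p, ‖(φ p).1‖ * ‖(φ p).2‖ ≤ C * (‖p.1‖ * ‖p.2‖)) (t : M ⊗[A] N) :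
    tensorNorm (g t) ≤ C * tensorNorm t := by
  have key : ∀ l : List (M × N), g (tensorEval l) = tensorEval (l.map φ) ∧
      tensorCost 𝒞 (l.map φ) ≤ C * tensorCost 𝒞 l := by
    intro l
    constructor
    · rw [tensorEval, map_list_sum, tensorEval, List.map_map, List.map_map]
      congr 1
      exact List.map_congr_left fun p _ => hg p
    · induction l with
      | nil => cases 𝒞 <;> simp [tensorCost]
      | cons p l ih =>
        cases 𝒞
        · simp only [tensorCost, List.map_cons, mul_add]; exact add_le_add (hφ p) ih
        · simp only [tensorCost, List.map_cons, mul_max_of_nonneg _ _ hC]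
          exact max_le_max (hφ p) ih
  refine le_of_forall_pos_le_add fun ε hε => ?_
  obtain ⟨l, rfl, hl⟩ := exists_tensorCost_lt t (c := tensorNorm t + ε / (C + 1))
    (lt_add_of_pos_right _ (by positivity))
  have h3 : C * (ε / (C + 1)) ≤ ε := by
    rw [mul_div_assoc', div_le_iff₀ (by positivity)]; nlinarith
  have h4 := mul_le_mul_of_nonneg_left hl.le hC
  rw [(key l).1]
  refine (tensorNorm_le _).trans ((key l).2.trans (h4.trans ?_))
  rw [mul_add]
  linarith

theorem tensorNorm_neg (t : M ⊗[A] N) : tensorNorm (-t) = tensorNorm t := by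
  have h : ∀ t : M ⊗[A] N, tensorNorm (-t) ≤ tensorNorm t := fun t => by
    have := tensorNorm_smul_le_of (C := 1) (-AddMonoidHom.id (M ⊗[A] N)) (fun p => (-p.1, p.2))
      (fun p => (TensorProduct.neg_tmul _ _).symm) zero_le_one (fun p => by simp) t
    simpa using this
  exact le_antisymm (h t) (by simpa using h (-t))

theorem exists_tensorNorm_smul_bound : ∃ C : ℝ, 0 ≤ C ∧ ∀ (a : A) (t : M ⊗[A] N),
    tensorNorm (a • t) ≤ C * ‖a‖ * tensorNorm t := by
  obtain ⟨C, hC, h⟩ := M.smul_bound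
  refine ⟨C, hC, fun a t => ?_⟩
  refine tensorNorm_smul_le_of (DistribSMul.toAddMonoidHom (M ⊗[A] N) a) (fun p => (a • p.1, p.2))
    (fun p => (TensorProduct.smul_tmul' _ _ _).symm) (by positivity) (fun p => ?_) t
  rw [← mul_assoc]
  exact mul_le_mul_of_nonneg_right (h a p.1) (norm_nonneg _)

/-- The algebraic tensor product over `A`, carrying the tensor seminorm. -/
def PreTensor (M N : BanMod 𝒞 A) : Type u := M ⊗[A] N

noncomputable instance : AddCommGroup (PreTensor M N) :=
  inferInstanceAs (AddCommGroup (M ⊗[A] N))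

noncomputable instance : Module A (PreTensor M N) :=
  inferInstanceAs (Module A (M ⊗[A] N))

noncomputable instance : SeminormedAddCommGroup (PreTensor M N) :=
  AddGroupSeminorm.toSeminormedAddCommGroup
    { toFun := fun t => tensorNorm (𝒞 := 𝒞) (M := M) (N := N) t
      map_zero' := tensorNorm_zero
      neg' := tensorNorm_neg
      add_le' := tensorNorm_add_le }

theorem PreTensor.norm_def (t : PreTensor M N) :
    ‖t‖ = tensorNorm (𝒞 := 𝒞) (M := M) (N := N) t := rfl

instance : UniformContinuousConstSMul A (PreTensor M N) where
  uniformContinuous_const_smul a := by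
    obtain ⟨C, hC, h⟩ := exists_tensorNorm_smul_bound (M := M) (N := N)
    refine (LipschitzWith.of_dist_le_mul (K := (C * ‖a‖).toNNReal) fun x y => ?_).uniformContinuous
    rw [dist_eq_norm, dist_eq_norm, ← smul_sub, Real.coe_toNNReal _ (by positivity)]
    exact h a (x - y)

/-- The identity map, from `PreTensor` to the algebraic tensor product. -/
noncomputable def PreTensor.out (M N : BanMod 𝒞 A) : PreTensor M N →ₗ[A] M ⊗[A] N where
  toFun t := t
  map_add' _ _ := rfl
  map_smul' _ _ := rfl

theorem PreTensor.norm_smul_bound (M N : BanMod 𝒞 A) : ∃ C : ℝ, ∀ (a : A) (t : PreTensor M N),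
    ‖a • t‖ ≤ C * ‖a‖ * ‖t‖ := by
  obtain ⟨C, hC, h⟩ := exists_tensorNorm_smul_bound (M := M) (N := N)
  exact ⟨C, h⟩

theorem PreTensor.norm_add_le_max (h : 𝒞 = .nonarch) (s t : PreTensor M N) :
    ‖s + t‖ ≤ max ‖s‖ ‖t‖ :=
  tensorNorm_add_le_max h s t

theorem completion_isUltrametricDist {E : Type u} [SeminormedAddCommGroup E]
    (h : ∀ s t : E, ‖s + t‖ ≤ max ‖s‖ ‖t‖) :
    IsUltrametricDist (UniformSpace.Completion E) := by
  refine IsUltrametricDist.isUltrametricDist_of_forall_norm_add_le_max_norm fun x y => ?_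
  refine UniformSpace.Completion.induction_on₂ x y
    (isClosed_le (by fun_prop) (by fun_prop)) fun s t => ?_
  rw [← UniformSpace.Completion.coe_add]
  simp only [UniformSpace.Completion.norm_coe]
  exact h s t

theorem completion_norm_smul_le {E : Type u} [SeminormedAddCommGroup E] [Module A E]
    [UniformContinuousConstSMul A E] {C : ℝ} (h : ∀ (a : A) (t : E), ‖a • t‖ ≤ C * ‖a‖ * ‖t‖)
    (a : A) (x : UniformSpace.Completion E) : ‖a • x‖ ≤ C * ‖a‖ * ‖x‖ := by
  refine UniformSpace.Completion.induction_on x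
    (isClosed_le ((continuous_const_smul a).norm) (continuous_const.mul continuous_norm))
    fun t => ?_
  rw [← UniformSpace.Completion.coe_smul]
  simp only [UniformSpace.Completion.norm_coe]
  exact h a t

/-- The completed tensor product `M ⊗̂_A N`: the completion of `M ⊗_A N` for the tensor
seminorm. -/
noncomputable def BanMod.tensor (M N : BanMod 𝒞 A) : BanMod 𝒞 A where
  carrier := UniformSpace.Completion (PreTensor M N)
  kind := ⟨fun h => completion_isUltrametricDist (PreTensor.norm_add_le_max h)⟩
  exists_smul_bound :=
    let ⟨C, hC⟩ := PreTensor.norm_smul_bound M N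
    ⟨C, completion_norm_smul_le hC⟩

/-- The canonical map from the algebraic to the completed tensor product. -/
noncomputable def BanMod.tensorMk (M N : BanMod 𝒞 A) : M ⊗[A] N →ₗ[A] M.tensor N where
  toFun t := UniformSpace.Completion.coe' (show PreTensor M N from t)
  map_add' s t := UniformSpace.Completion.coe_add (show PreTensor M N from s)
    (show PreTensor M N from t)
  map_smul' a t := UniformSpace.Completion.coe_smul a (show PreTensor M N from t)

/-- The canonical bounded bilinear map `(m, n) ↦ m ⊗ n` to the completed tensor product. -/
noncomputable def BanMod.tmul (M N : BanMod 𝒞 A) : M →ₗ[A] N →ₗ[A] M.tensor N :=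
  (TensorProduct.mk A M N).compr₂ (M.tensorMk N)

theorem BanMod.norm_tmul_le (m : M) (n : N) : ‖M.tmul N m n‖ ≤ ‖m‖ * ‖n‖ := by
  have h1 : ‖M.tmul N m n‖ = tensorNorm (m ⊗ₜ[A] n) :=
    UniformSpace.Completion.norm_coe (E := PreTensor M N) _
  have h2 := tensorNorm_le (𝒞 := 𝒞) [(m, n)]
  have h3 : tensorCost 𝒞 [(m, n)] = ‖m‖ * ‖n‖ := by
    cases 𝒞
    · simp [tensorCost]
    · simp only [tensorCost]; exact max_eq_left (by positivity)
  rw [h1, ← h3]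
  simpa [tensorEval] using h2

theorem completion_exists_lift {E : Type u} [SeminormedAddCommGroup E] [Module A E]
    [UniformContinuousConstSMul A E] (T : BanMod 𝒞 A) (f : E →ₗ[A] T) {C : ℝ} (hC : 0 ≤ C)
    (hf : ∀ x, ‖f x‖ ≤ C * ‖x‖) :
    ∃ g : UniformSpace.Completion E →ₗ[A] T, (∀ x : E, g x = f x) ∧ ∀ x, ‖g x‖ ≤ C * ‖x‖ := by
  have hu : UniformContinuous f := by
    refine (LipschitzWith.of_dist_le_mul (K := C.toNNReal) fun x y => ?_).uniformContinuous
    rw [dist_eq_norm, dist_eq_norm, ← map_sub, Real.coe_toNNReal _ hC]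
    exact hf _
  have hc : Continuous (UniformSpace.Completion.extension f) :=
    UniformSpace.Completion.continuous_extension
  have hs : ∀ a : A, Continuous fun x : T => a • x := by
    intro a
    obtain ⟨D, hD, h⟩ := T.smul_bound
    refine (LipschitzWith.of_dist_le_mul (K := (D * ‖a‖).toNNReal) fun x y => ?_).continuous
    rw [dist_eq_norm, dist_eq_norm, ← smul_sub, Real.coe_toNNReal _ (by positivity)]
    exact h a (x - y)
  have he : ∀ x : E, UniformSpace.Completion.extension f (x : UniformSpace.Completion E) = f x :=
    UniformSpace.Completion.extension_coe hu
  refine ⟨{ toFun := UniformSpace.Completion.extension f, map_add' := ?_, map_smul' := ?_ },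
    he, ?_⟩
  · intro x y
    refine UniformSpace.Completion.induction_on₂ x y
      (isClosed_eq (by fun_prop) (by fun_prop)) fun s t => ?_
    rw [← UniformSpace.Completion.coe_add, he, he, he, map_add]
  · intro a x
    refine UniformSpace.Completion.induction_on x
      (isClosed_eq (hc.comp (continuous_const_smul a)) ((hs a).comp hc)) fun t => ?_
    rw [← UniformSpace.Completion.coe_smul, he, he, map_smul]
    rfl
  · intro x
    refine UniformSpace.Completion.induction_on x
      (isClosed_le hc.norm (continuous_const.mul continuous_norm)) fun t => ?_
    change ‖UniformSpace.Completion.extension f _‖ ≤ _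
    rw [he, UniformSpace.Completion.norm_coe]
    exact hf t

theorem BanMod.exists_tensorLift (β : M →ₗ[A] N →ₗ[A] T)
    (hβ : ∃ C : ℝ, ∀ m n, ‖β m n‖ ≤ C * (‖m‖ * ‖n‖)) :
    ∃ g : BanHom (M.tensor N) T, ∀ m n, g (M.tmul N m n) = β m n := by
  obtain ⟨C, hC⟩ := hβ
  have hC' : ∀ m n, ‖β m n‖ ≤ max C 0 * (‖m‖ * ‖n‖) := fun m n => (hC m n).trans (by
    gcongr
    exact le_max_left _ _)
  obtain ⟨g, hg, hb⟩ := completion_exists_lift (E := PreTensor M N) T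
    (TensorProduct.lift β ∘ₗ PreTensor.out M N) (le_max_right C 0)
    (fun t => norm_le_tensorNorm (TensorProduct.lift β).toAddMonoidHom (le_max_right C 0) (fun m n => by simpa using hC' m n) t)
  exact ⟨⟨g, _, hb⟩, fun m n => (hg _).trans (TensorProduct.lift.tmul m n)⟩

/-- The morphism `M ⊗̂ N → T` induced by a bounded bilinear map. -/
noncomputable def BanMod.tensorLift (β : M →ₗ[A] N →ₗ[A] T)
    (hβ : ∃ C : ℝ, ∀ m n, ‖β m n‖ ≤ C * (‖m‖ * ‖n‖)) : BanHom (M.tensor N) T :=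
  (BanMod.exists_tensorLift β hβ).choose

theorem BanMod.tensorLift_tmul (β : M →ₗ[A] N →ₗ[A] T)
    (hβ : ∃ C : ℝ, ∀ m n, ‖β m n‖ ≤ C * (‖m‖ * ‖n‖)) (m : M) (n : N) :
    BanMod.tensorLift β hβ (M.tmul N m n) = β m n :=
  (BanMod.exists_tensorLift β hβ).choose_spec m n

/-- Two morphisms out of a completed tensor product agree if they agree on pure tensors, so
`tensorLift` is the only morphism with the stated values on pure tensors. -/
theorem BanMod.tensor_hom_ext {f g : BanHom (M.tensor N) T}
    (h : ∀ m n, f (M.tmul N m n) = g (M.tmul N m n)) : f = g := by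
  have hc : ∀ f : BanHom (M.tensor N) T, Continuous f := fun f => by
    obtain ⟨C, hC, hf⟩ := f.bound
    refine (LipschitzWith.of_dist_le_mul (K := C.toNNReal) fun x y => ?_).continuous
    rw [dist_eq_norm, dist_eq_norm, ← map_sub, Real.coe_toNNReal _ hC]
    exact hf _
  refine DFunLike.ext _ _ fun x => ?_
  refine UniformSpace.Completion.induction_on (α := PreTensor M N) x
    (isClosed_eq (hc f) (hc g)) fun t => ?_
  suffices H : ∀ t : M ⊗[A] N, f (M.tensorMk N t) = g (M.tensorMk N t) from H t
  intro t
  induction t with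
  | zero => rw [map_zero, map_zero, map_zero]
  | tmul m n => exact h m n
  | add s t hs ht => rw [map_add, map_add, map_add, hs, ht]

variable {M' N' : BanMod 𝒞 A}

/-- The morphism `f ⊗̂ g`, with `(f ⊗̂ g) (m ⊗ n) = f m ⊗ g n`. -/
noncomputable def BanHom.tensorMap (f : BanHom M M') (g : BanHom N N') :
    BanHom (M.tensor N) (M'.tensor N') :=
  BanMod.tensorLift ((M'.tmul N').compl₁₂ f.toLinearMap g.toLinearMap) (by
    obtain ⟨C, hC, hf⟩ := f.bound
    obtain ⟨D, hD, hg⟩ := g.bound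
    refine ⟨C * D, fun m n => (BanMod.norm_tmul_le (f m) (g n)).trans ?_⟩
    calc ‖f m‖ * ‖g n‖ ≤ (C * ‖m‖) * (D * ‖n‖) := by
          gcongr
          · exact hf m
          · exact hg n
      _ = C * D * (‖m‖ * ‖n‖) := by ring)

theorem BanHom.tensorMap_tmul (f : BanHom M M') (g : BanHom N N') (m : M) (n : N) :
    f.tensorMap g (M.tmul N m n) = M'.tmul N' (f m) (g n) :=
  BanMod.tensorLift_tmul _ _ m n

theorem BanHom.tensorMap_comp {M'' N'' : BanMod 𝒞 A} (f : BanHom M M') (g : BanHom N N')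
    (f' : BanHom M' M'') (g' : BanHom N' N'') :
    (f'.tensorMap g').comp (f.tensorMap g) = (f'.comp f).tensorMap (g'.comp g) :=
  BanMod.tensor_hom_ext fun m n => by
    simp only [BanHom.comp_apply, BanHom.tensorMap_tmul]

theorem BanHom.zero_tensorMap (g : BanHom N N') :
    (0 : BanHom M M').tensorMap g = 0 :=
  BanMod.tensor_hom_ext fun m n => by
    simp only [BanHom.tensorMap_tmul, BanHom.zero_apply, map_zero, LinearMap.zero_apply]

theorem BanHom.tensorMap_zero (f : BanHom M M') :
    f.tensorMap (0 : BanHom N N') = 0 :=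
  BanMod.tensor_hom_ext fun m n => by
    simp only [BanHom.tensorMap_tmul, BanHom.zero_apply, map_zero]

/-- The morphism `N → M ⊗̂ N`, `n ↦ m ⊗ n`. -/
noncomputable def BanMod.tmulLeft (m : M) (N : BanMod 𝒞 A) : BanHom N (M.tensor N) where
  toLinearMap := M.tmul N m
  exists_bound := ⟨‖m‖, fun n => BanMod.norm_tmul_le m n⟩

end Tensor

/-! ### Chain complexes -/

/-- Chain complexes `⋯ → X 2 → X 1 → X 0 → 0` of `Mod_𝒞(A)` in non-negative homological degrees. -/
structure BanComplex (𝒞 : BanachKind) (A : Type u) [BanachRing A] where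
  X : ℕ → BanMod 𝒞 A
  d : ∀ n, BanHom (X (n + 1)) (X n)
  d_comp_d : ∀ n, (d n).comp (d (n + 1)) = 0

namespace BanComplex

variable {𝒞 : BanachKind} {A : Type u} [BanachRing A]

/-- The index set `{(i, j) | i + j = n}`. -/
abbrev TotIdx (n : ℕ) : Type := {p : ℕ × ℕ // p.1 + p.2 = n}

instance (n : ℕ) : Finite (TotIdx n) :=
  Set.Finite.to_subtype ((Finset.HasAntidiagonal.antidiagonal n).finite_toSet.subset
    fun p hp => by simpa using (show p.1 + p.2 = n from hp))

/-- The differential of the total complex of `P ⊗̂ Q`: its component of index `(i, j)` is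
`x ↦ (d ⊗ id) x_{i+1,j} + (-1)^i (id ⊗ d) x_{i,j+1}`. -/
noncomputable def totD (P Q : BanComplex 𝒞 A) (n : ℕ) :
    BanHom (BanMod.pi fun p : TotIdx (n + 1) => (P.X p.1.1).tensor (Q.X p.1.2))
      (BanMod.pi fun p : TotIdx n => (P.X p.1.1).tensor (Q.X p.1.2)) :=
  BanMod.piLift fun p =>
    ((P.d p.1.1).tensorMap (BanHom.id _)).comp
        (BanMod.proj (fun p : TotIdx (n + 1) => (P.X p.1.1).tensor (Q.X p.1.2))
          ⟨(p.1.1 + 1, p.1.2), by have := p.2; simp only; omega⟩) +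
      (-1 : ℤ) ^ p.1.1 • ((BanHom.id _).tensorMap (Q.d p.1.2)).comp
        (BanMod.proj (fun p : TotIdx (n + 1) => (P.X p.1.1).tensor (Q.X p.1.2))
          ⟨(p.1.1, p.1.2 + 1), by have := p.2; simp only; omega⟩)

theorem proj_comp_totD (P Q : BanComplex 𝒞 A) (n : ℕ) (p : TotIdx n) :
    (BanMod.proj (fun p : TotIdx n => (P.X p.1.1).tensor (Q.X p.1.2)) p).comp (totD P Q n) =
    ((P.d p.1.1).tensorMap (BanHom.id _)).comp
        (BanMod.proj (fun p : TotIdx (n + 1) => (P.X p.1.1).tensor (Q.X p.1.2))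
          ⟨(p.1.1 + 1, p.1.2), by have := p.2; simp only; omega⟩) +
      (-1 : ℤ) ^ p.1.1 • ((BanHom.id _).tensorMap (Q.d p.1.2)).comp
        (BanMod.proj (fun p : TotIdx (n + 1) => (P.X p.1.1).tensor (Q.X p.1.2))
          ⟨(p.1.1, p.1.2 + 1), by have := p.2; simp only; omega⟩) :=
  BanMod.proj_comp_piLift _ p

/-- The total complex `Tot(P ⊗̂ Q)`. -/
noncomputable def tot (P Q : BanComplex 𝒞 A) : BanComplex 𝒞 A where
  X n := BanMod.pi fun p : TotIdx n => (P.X p.1.1).tensor (Q.X p.1.2)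
  d n := totD P Q n
  d_comp_d n := by
    refine BanMod.pi_hom_ext fun p => ?_
    rw [← BanHom.comp_assoc, proj_comp_totD, BanHom.add_comp, BanHom.zsmul_comp,
      BanHom.comp_assoc, BanHom.comp_assoc, proj_comp_totD, proj_comp_totD]
    simp only [BanHom.comp_add, BanHom.comp_zsmul, ← BanHom.comp_assoc, BanHom.tensorMap_comp,
      P.d_comp_d, Q.d_comp_d, BanHom.zero_tensorMap, BanHom.tensorMap_zero, BanHom.zero_comp,
      BanHom.id_comp, BanHom.comp_id, zero_add, smul_zero, add_zero]
    rw [pow_succ, mul_neg_one, neg_smul, neg_add_cancel]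
    rfl

/-- The regular module as a complex concentrated in degree `0`. -/
def unit (𝒞 : BanachKind) (A : Type u) [BanachRing A] [IsOfKind 𝒞 A] : BanComplex 𝒞 A where
  X
    | 0 => BanMod.regular 𝒞 A
    | _ + 1 => BanMod.zero 𝒞 A
  d _ := 0
  d_comp_d _ := rfl

/-- The identity `X n → X m` for `n = m`. -/
def castX (K : BanComplex 𝒞 A) {n m : ℕ} (h : n = m) : BanHom (K.X n) (K.X m) :=
  h ▸ BanHom.id (K.X n)

/-- The chain map from `K` to the module `M` in degree `0` given by `ε : K_0 → M` is a
quasi-isomorphism, i.e. its mapping cone `⋯ → K_1 → K_0 → M → 0` is strictly exact. -/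
def IsQuasiIsoTo (K : BanComplex 𝒞 A) {M : BanMod 𝒞 A} (ε : BanHom (K.X 0) M) : Prop :=
  StrictExactAt ε (0 : BanHom M (BanMod.zero 𝒞 A)) ∧ StrictExactAt (K.d 0) ε ∧
    ∀ n, StrictExactAt (K.d (n + 1)) (K.d n)

end BanComplex

/-- A projective resolution of `M`. -/
structure BanResolution {𝒞 : BanachKind} {A : Type u} [BanachRing A] (M : BanMod 𝒞 A) where
  P : BanComplex 𝒞 A
  projective : ∀ n, (P.X n).IsProjective
  aug : BanHom (P.X 0) M
  quasiIso : P.IsQuasiIsoTo aug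

/-! ### Banach algebras -/

/-- Objects of `Alg_𝒞(A)`: commutative Banach `A`-algebras. -/
structure BanAlg (𝒞 : BanachKind) (A : Type u) [BanachRing A] where
  carrier : Type u
  [ring : BanachRing carrier]
  [algebra : Algebra A carrier]
  [kind : IsOfKind 𝒞 carrier]
  exists_smul_bound : ∃ C : ℝ, ∀ (a : A) (b : carrier), ‖a • b‖ ≤ C * ‖a‖ * ‖b‖

namespace BanAlg

variable {𝒞 : BanachKind} {A : Type u} [BanachRing A]

instance : CoeSort (BanAlg 𝒞 A) (Type u) := ⟨BanAlg.carrier⟩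

attribute [instance] BanAlg.ring BanAlg.algebra BanAlg.kind

/-- The underlying Banach module. -/
def toMod (B : BanAlg 𝒞 A) : BanMod 𝒞 A where
  carrier := B
  exists_smul_bound := B.exists_smul_bound

/-- The multiplication `B ⊗̂_A B → B`. -/
noncomputable def mul (B : BanAlg 𝒞 A) : BanHom (B.toMod.tensor B.toMod) B.toMod :=
  BanMod.tensorLift (M := B.toMod) (N := B.toMod) (T := B.toMod) (LinearMap.mul A B) (by
    obtain ⟨C, hC⟩ := BanachRing.exists_mul_bound (R := B)
    exact ⟨C, fun a b => (hC a b).trans_eq (mul_assoc _ _ _)⟩)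

/-- The structure morphism `A → B` is an epimorphism of Banach algebras. -/
def IsEpi (B : BanAlg 𝒞 A) : Prop :=
  ∀ (D : BanAlg 𝒞 A) (f g : B →ₐ[A] D),
    (∃ C : ℝ, ∀ b, ‖f b‖ ≤ C * ‖b‖) → (∃ C : ℝ, ∀ b, ‖g b‖ ≤ C * ‖b‖) →
    f.comp (Algebra.ofId A B) = g.comp (Algebra.ofId A B) → f = g

/-- For resolutions `P` and `Q` of the module underlying `B`, so that `Tot(P ⊗̂ Q)` represents
`B ⊗̂^𝕃 B`: the morphism `Tot(P ⊗̂ Q) → B ⊗̂ B → B` representing the multiplication, in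
degree `0`. -/
noncomputable def derivedMul (B : BanAlg 𝒞 A) (P Q : BanResolution B.toMod) :
    BanHom ((P.P.tot Q.P).X 0) B.toMod :=
  B.mul.comp ((P.aug.tensorMap Q.aug).comp
    (BanMod.proj (fun p : BanComplex.TotIdx 0 => (P.P.X p.1.1).tensor (Q.P.X p.1.2))
      ⟨(0, 0), rfl⟩))

/-- The structure morphism `A → B` is a homotopy epimorphism: the multiplication
`B ⊗̂_A^𝕃 B → B` is an isomorphism in the derived category, i.e. it is represented by a
quasi-isomorphism `Tot(P ⊗̂ Q) → B`, for any projective resolutions `P` and `Q` of `B`. -/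
def IsHomotopyEpi (B : BanAlg 𝒞 A) : Prop :=
  Nonempty (BanResolution B.toMod) ∧
    ∀ P Q : BanResolution B.toMod, (P.P.tot Q.P).IsQuasiIsoTo (B.derivedMul P Q)

/-- A projective resolution of the module underlying `B`, together with an element of degree `0`
over `1`. Such an element is the same as a lift `A → P` of the structure morphism `A → B`. -/
structure UnitalResolution (B : BanAlg 𝒞 A) extends BanResolution B.toMod where
  one : P.X 0
  aug_one : aug one = (1 : B)

end BanAlg

/-! ### Quotients by closed ideals -/

section Quotient

variable {R : Type u} [BanachRing R]

theorem quotient_norm_mul_bound (I : Ideal R) :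
    ∃ C : ℝ, ∀ a b : R ⧸ I, ‖a * b‖ ≤ C * ‖a‖ * ‖b‖ := by
  obtain ⟨C, hC⟩ := BanachRing.exists_mul_bound (R := R)
  refine ⟨max C 0, fun a b => ?_⟩
  have h : ∀ ε > 0, ‖a * b‖ ≤ max C 0 * (‖a‖ + ε) * (‖b‖ + ε) := fun ε hε => by
    obtain ⟨x, rfl, hx⟩ := Submodule.Quotient.norm_mk_lt a hε
    obtain ⟨y, rfl, hy⟩ := Submodule.Quotient.norm_mk_lt b hε
    refine (Submodule.Quotient.norm_mk_le I (x * y)).trans ((hC x y).trans ?_)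
    gcongr
    exact le_max_left _ _
  have hc : Filter.Tendsto (fun ε : ℝ => max C 0 * (‖a‖ + ε) * (‖b‖ + ε))
      (nhdsWithin 0 (Set.Ioi 0)) (nhds (max C 0 * (‖a‖ + 0) * (‖b‖ + 0))) :=
    (Continuous.tendsto (by fun_prop) 0).mono_left nhdsWithin_le_nhds
  rw [add_zero, add_zero] at hc
  exact ge_of_tendsto hc (Filter.eventually_of_mem self_mem_nhdsWithin h)

/-- The quotient of a Banach ring by a closed ideal, with the quotient norm. -/
noncomputable abbrev quotientBanachRing (I : Ideal R) (hI : IsClosed (I : Set R)) :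
    BanachRing (R ⧸ I) :=
  letI : NormedAddCommGroup (R ⧸ I) := @Submodule.Quotient.normedAddCommGroup R _ R _ _ I hI
  { (inferInstance : CommRing (R ⧸ I)), (inferInstance : NormedAddCommGroup (R ⧸ I)) with
    dist_eq_norm_sub := fun x y => dist_eq_norm x y
    complete := Submodule.Quotient.completeSpace I
    exists_mul_bound := quotient_norm_mul_bound I }

/-- The Banach `R`-algebra `R / I` for a closed ideal `I`. -/
noncomputable def BanAlg.quotient (𝒞 : BanachKind) [hR : IsOfKind 𝒞 R] (I : Ideal R)
    (hI : IsClosed (I : Set R)) : BanAlg 𝒞 R :=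
  letI := quotientBanachRing I hI
  { carrier := R ⧸ I
    kind := ⟨fun h => by
      have := hR.ultra h
      refine IsUltrametricDist.isUltrametricDist_of_forall_norm_add_le_max_norm fun a b => ?_
      refine le_of_forall_pos_le_add fun ε hε => ?_
      obtain ⟨x, rfl, hx⟩ := Submodule.Quotient.norm_mk_lt a hε
      obtain ⟨y, rfl, hy⟩ := Submodule.Quotient.norm_mk_lt b hε
      refine (Submodule.Quotient.norm_mk_le I (x + y)).trans ?_
      rw [← max_add_add_right]
      exact (IsUltrametricDist.norm_add_le_max x y).trans (max_le_max hx.le hy.le)⟩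
    exists_smul_bound := by
      obtain ⟨C, hC⟩ := quotient_norm_mul_bound I
      refine ⟨max C 0, fun a b => ?_⟩
      rw [Algebra.smul_def]
      refine (hC _ _).trans ?_
      gcongr
      · exact le_max_left _ _
      · exact Submodule.Quotient.norm_mk_le I a }

end Quotient

/-! ### Tate–Čech complexes and covers -/

section Cech

variable {𝒞 : BanachKind} {A : Type u} [BanachRing A] [IsOfKind 𝒞 A]

/-- The tensor product `M_{i_0} ⊗̂ (M_{i_1} ⊗̂ (⋯ ⊗̂ A))` along a list of indices; the empty tensor
product is `A`. -/
noncomputable def tensorList {ι : Type} (M : ι → BanMod 𝒞 A) : List ι → BanMod 𝒞 A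
  | [] => BanMod.regular 𝒞 A
  | i :: l => (M i).tensor (tensorList M l)

/-- The coface map which inserts the unit `e` at position `j`:
`x_0 ⊗ ⋯ ⊗ x_{j-1} ⊗ x_{j+1} ⊗ ⋯ ↦ x_0 ⊗ ⋯ ⊗ x_{j-1} ⊗ e ⊗ x_{j+1} ⊗ ⋯`. -/
noncomputable def coface {ι : Type} (M : ι → BanMod 𝒞 A) (e : ∀ i, M i) :
    ∀ (l : List ι) (j : ℕ), BanHom (tensorList M (l.eraseIdx j)) (tensorList M l)
  | [], _ => BanHom.id _
  | i :: l, 0 => BanMod.tmulLeft (e i) (tensorList M l)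
  | i :: l, j + 1 => (BanHom.id (M i)).tensorMap (coface M e l j)

/-- Strictly increasing tuples of length `p` in `{0, …, m - 1}`. -/
abbrev CechIdx (m p : ℕ) : Type :=
  {l : List (Fin m) // l.Pairwise (· < ·) ∧ l.length = p}

theorem finite_pairwise_lt (m : ℕ) : {l : List (Fin m) | l.Pairwise (· < ·)}.Finite := by
  refine (List.finite_length_le (Fin m) m).subset fun l hl => ?_
  have hl' : l.Pairwise (· < ·) := hl
  have hn : l.Nodup := hl'.imp fun h => ne_of_lt h
  simpa using hn.length_le_card

instance (m p : ℕ) : Finite (CechIdx m p) :=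
  Set.Finite.to_subtype ((finite_pairwise_lt m).subset fun _ h => h.1)

/-- The term of degree `p` of the Tate–Čech complex of the family `B`:
the product of the `B_{i_0} ⊗̂ ⋯ ⊗̂ B_{i_{p-1}}` over `i_0 < ⋯ < i_{p-1}`. -/
noncomputable def cechX {m : ℕ} (B : Fin m → BanAlg 𝒞 A) (p : ℕ) : BanMod 𝒞 A :=
  BanMod.pi fun l : CechIdx m p => tensorList (fun i => (B i).toMod) l.1

/-- The differential of the Tate–Čech complex: the alternating sum of the coface maps. -/
noncomputable def cechD {m : ℕ} (B : Fin m → BanAlg 𝒞 A) (p : ℕ) :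
    BanHom (cechX B p) (cechX B (p + 1)) :=
  BanMod.piLift fun l => ∑ j : Fin l.1.length, (-1 : ℤ) ^ (j : ℕ) •
    (coface (fun i => (B i).toMod) (fun i => (1 : B i)) l.1 j).comp
      (BanMod.proj (fun l : CechIdx m p => tensorList (fun i => (B i).toMod) l.1)
        ⟨l.1.eraseIdx j, l.2.1.sublist (List.eraseIdx_sublist _ _), by
          rw [List.length_eraseIdx_of_lt j.2, l.2.2, Nat.add_sub_cancel]⟩)

/-- Tate's acyclicity: the complex `0 → A → ∏ B_i → ∏ B_i ⊗̂ B_j → ⋯` is strictly exact. -/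
def TateAcyclic {m : ℕ} (B : Fin m → BanAlg 𝒞 A) : Prop :=
  StrictExactAt (0 : BanHom (BanMod.zero 𝒞 A) (cechX B 0)) (cechD B 0) ∧
    ∀ p, StrictExactAt (cechD B p) (cechD B (p + 1))

/-- The tensor product complex `Tot(P_{i_0} ⊗̂ (P_{i_1} ⊗̂ (⋯ ⊗̂ A)))` along a list of indices. -/
noncomputable def tensorListC {ι : Type} (P : ι → BanComplex 𝒞 A) : List ι → BanComplex 𝒞 A
  | [] => BanComplex.unit 𝒞 A
  | i :: l => (P i).tot (tensorListC P l)

/-- The coface map which inserts the degree `0` element `e` at position `j`, in degree `q`. -/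
noncomputable def cofaceC {ι : Type} (P : ι → BanComplex 𝒞 A) (e : ∀ i, (P i).X 0) :
    ∀ (l : List ι) (j q : ℕ), BanHom ((tensorListC P (l.eraseIdx j)).X q) ((tensorListC P l).X q)
  | [], _, _ => BanHom.id _
  | i :: l, 0, q => BanMod.piLift fun p : BanComplex.TotIdx q =>
      match p with
      | ⟨(0, b), h⟩ => (BanMod.tmulLeft (e i) ((tensorListC P l).X b)).comp
          ((tensorListC P l).castX (by rw [← h]; exact Nat.zero_add b))
      | ⟨(_ + 1, _), _⟩ => 0
  | i :: l, j + 1, q => BanMod.piLift fun p : BanComplex.TotIdx q =>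
      ((BanHom.id ((P i).X p.1.1)).tensorMap (cofaceC P e l j p.1.2)).comp
        (BanMod.proj (fun p : BanComplex.TotIdx q =>
          ((P i).X p.1.1).tensor ((tensorListC P (l.eraseIdx j)).X p.1.2)) p)

/-- Indices of the terms of total degree `n` of the derived Tate–Čech complex: a strictly increasing
tuple `l` (Čech degree `length l`) and a homological degree `q` with `length l - q = n`. -/
abbrev DerivedCechIdx (m : ℕ) (n : ℤ) : Type :=
  {x : List (Fin m) × ℕ // x.1.Pairwise (· < ·) ∧ (x.1.length : ℤ) - x.2 = n}

instance (m : ℕ) (n : ℤ) : Finite (DerivedCechIdx m n) :=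
  have := (finite_pairwise_lt m).to_subtype
  Finite.of_injective
    (fun x : DerivedCechIdx m n =>
      (⟨x.1.1, x.2.1⟩ : {l : List (Fin m) | l.Pairwise (· < ·)})) fun x y h => by
    have h1 : x.1.1 = y.1.1 := congrArg Subtype.val h
    have h2 := x.2.2
    have h3 := y.2.2
    rw [h1] at h2
    exact Subtype.ext (Prod.ext h1 (by omega))

/-- The term of degree `n` of the total complex of the derived Tate–Čech complex. -/
noncomputable def derivedCechX {m : ℕ} (P : Fin m → BanComplex 𝒞 A) (n : ℤ) : BanMod 𝒞 A :=
  BanMod.pi fun x : DerivedCechIdx m n => (tensorListC P x.1.1).X x.1.2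

/-- The differential of the total complex of the derived Tate–Čech complex: the alternating sum of
the coface maps plus `(-1)^p` times the differential of the tensor product complexes in
Čech degree `p`. -/
noncomputable def derivedCechD {m : ℕ} (P : Fin m → BanComplex 𝒞 A) (e : ∀ i, (P i).X 0) (n : ℤ) :
    BanHom (derivedCechX P n) (derivedCechX P (n + 1)) :=
  BanMod.piLift fun y =>
    ∑ j : Fin y.1.1.length, (-1 : ℤ) ^ (j : ℕ) • (cofaceC P e y.1.1 j y.1.2).comp
      (BanMod.proj (fun x : DerivedCechIdx m n => (tensorListC P x.1.1).X x.1.2)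
        ⟨(y.1.1.eraseIdx j, y.1.2), y.2.1.sublist (List.eraseIdx_sublist _ _), by
          have h1 := y.2.2
          have h2 := j.2
          simp only [List.length_eraseIdx_of_lt h2]
          omega⟩) +
    (-1 : ℤ) ^ y.1.1.length • ((tensorListC P y.1.1).d y.1.2).comp
      (BanMod.proj (fun x : DerivedCechIdx m n => (tensorListC P x.1.1).X x.1.2)
        ⟨(y.1.1, y.1.2 + 1), y.2.1, by
          have h1 := y.2.2
          push_cast
          omega⟩)

/-- Derived Tate's acyclicity: the total complex of
`0 → A → ∏ B_i → ∏ B_i ⊗̂^𝕃 B_j → ⋯` is strictly exact, the derived tensor products being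
computed by any projective resolutions of the `B_i` and any lifts of the structure morphisms. -/
def DerivedTateAcyclic {m : ℕ} (B : Fin m → BanAlg 𝒞 A) : Prop :=
  (∀ i, Nonempty (B i).UnitalResolution) ∧
    ∀ P : ∀ i, (B i).UnitalResolution, ∀ n : ℤ,
      StrictExactAt (derivedCechD (fun i => (P i).P) (fun i => (P i).one) n)
        (derivedCechD (fun i => (P i).P) (fun i => (P i).one) (n + 1))

/-- A set `S` of Banach `A`-algebras is a derived cover of `A`. The finite subset of `S` is given by
an enumeration `B` without repetitions. -/
def IsDerivedCover (S : Set (BanAlg 𝒞 A)) : Prop :=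
  (∀ B ∈ S, B.IsHomotopyEpi) ∧
    ∃ (m : ℕ) (B : Fin m → BanAlg 𝒞 A), Function.Injective B ∧ (∀ i, B i ∈ S) ∧
      DerivedTateAcyclic B

/-- A set `S` of Banach `A`-algebras is a non-derived cover of `A`. -/
def IsNonDerivedCover (S : Set (BanAlg 𝒞 A)) : Prop :=
  (∀ B ∈ S, B.IsEpi) ∧
    ∃ (m : ℕ) (B : Fin m → BanAlg 𝒞 A), Function.Injective B ∧ (∀ i, B i ∈ S) ∧ TateAcyclic B

end Cech

/-! ### Strict exactness, kernels and lifting -/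

section Basic

variable {𝒞 : BanachKind} {A : Type u} [BanachRing A] {M N T : BanMod 𝒞 A}

/-! For an idempotent `e`, the ideal `eR` is the kernel of multiplication by `1 - e`, so it is
closed, and `B = R/eR` is a direct factor of `R`: multiplication by `1 - e` descends to a bounded
map `π : B → R`. Hence `B` is projective. Since `R → B` is onto, `a•1 ⊗ c = 1 ⊗ a•c`, so the
multiplication of `B ⊗̂ B` is an isomorphism. A projective resolution of a projective module has a
bounded contraction (`BanResolution.nonempty_contraction`), and contractions can be tensored
(`BanComplex.Contraction.tot`). So `B ⊗̂^𝕃 B` reduces to `B ⊗̂ B`, and `R → B` is a homotopy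
epimorphism.

For covers, only one property of the idempotents `e_0, …, e_{m-1}` matters: their product is zero.
For an orthogonal family other than `{1}` two factors already annihilate each other (or `1 = 0`);
for the complements, `∏ (1 - e) = 1 - ∑ e = 0`. Put `a_i = ∏_{k<i} e_k`. The weights `a_i (1 - e_i)`
telescope to `1 - ∏ e_i = 1`, and `φ_i = a_i π_i : B_i → R` takes the unit to the weight of index
`i`. For `k < i` the factor `e_k` of `a_i` acts by zero on `B_k`. Contracting the first tensor
factor with `φ_i` and summing over the `i` smaller than all the other indices gives a bounded
operator that finds a primitive for each Čech cocycle (`CechSplitting.cechFun_homotopy`), whence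
`CechSplitting.tateAcyclic`.

In the derived case each column of the double complex contracts onto a term of the ordinary Čech
complex. The operator above, lifted along the column augmentations, corrects a cocycle so that its
augmentation vanishes. The column contractions then remove what remains, one Čech degree at a time
(`IsReducedCocycle.sub_columnHomotopy`), and this stops because increasing tuples in `Fin m` have
length at most `m`. Every primitive comes from a single bounded operator, so exactness is
automatically strict (`strictExactAt_of_operator`). -/

theorem BanHom.continuous (f : BanHom M N) : Continuous f := by
  obtain ⟨C, hC, hf⟩ := f.bound
  refine (LipschitzWith.of_dist_le_mul (K := C.toNNReal) fun x y => ?_).continuous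
  rw [dist_eq_norm, dist_eq_norm, ← map_sub, Real.coe_toNNReal _ hC]
  exact hf _

theorem BanHom.ext {f g : BanHom M N} (h : ∀ x, f x = g x) : f = g := DFunLike.ext _ _ h

theorem BanHom.sub_apply (f g : BanHom M N) (x : M) : (f - g) x = f x - g x := by
  rw [sub_eq_add_neg, BanHom.add_apply, BanHom.neg_apply, sub_eq_add_neg]

theorem BanHom.comp_zero (g : BanHom N T) : g.comp (0 : BanHom M N) = 0 :=
  BanHom.ext fun _ => map_zero g

/-- Strict exactness from bounded preimages of all cycles. -/
theorem strictExactAt_of_exists_bound {f : BanHom M N} {g : BanHom N T}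
    (hgf : ∀ x, g (f x) = 0)
    (h : ∃ C : ℝ, ∀ y, g y = 0 → ∃ x, f x = y ∧ ‖x‖ ≤ C * ‖y‖) : StrictExactAt f g := by
  obtain ⟨C, hC⟩ := h
  have hr : Set.range f = {y | g y = 0} := by
    ext y
    constructor
    · rintro ⟨x, rfl⟩
      exact hgf x
    · intro hy
      obtain ⟨x, hx, -⟩ := hC y hy
      exact ⟨x, hx⟩
  have hcl : IsClosed (Set.range f) := by
    rw [hr]
    exact isClosed_eq g.continuous continuous_const
  exact ⟨by rw [hcl.closure_eq, hr], hcl, C, fun x => hC (f x) (hgf x)⟩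

/-- Strict exactness from a bounded operator that gives preimages of all cycles. -/
theorem strictExactAt_of_operator {f : BanHom M N} {g : BanHom N T}
    (hgf : ∀ x, g (f x) = 0) (h : BanHom N M) (hh : ∀ y, g y = 0 → f (h y) = y) :
    StrictExactAt f g := by
  obtain ⟨C, hC⟩ := h.exists_bound
  exact strictExactAt_of_exists_bound hgf ⟨C, fun y hy => ⟨h y, hh y hy, hC y⟩⟩

namespace StrictExactAt

variable {f : BanHom M N} {g : BanHom N T}

theorem range_eq (h : StrictExactAt f g) : Set.range f = {y | g y = 0} := by
  rw [← h.1, h.2.1.closure_eq]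

theorem comp_apply (h : StrictExactAt f g) (x : M) : g (f x) = 0 := by
  have : f x ∈ Set.range f := ⟨x, rfl⟩
  rwa [h.range_eq] at this

end StrictExactAt

/-- The kernel of a morphism. -/
def BanMod.ker (g : BanHom N T) : BanMod 𝒞 A where
  carrier := LinearMap.ker g.toLinearMap
  complete := by
    have hc : IsClosed ((LinearMap.ker g.toLinearMap : Submodule A N) : Set N) :=
      isClosed_eq g.continuous continuous_const
    exact hc.completeSpace_coe
  kind := ⟨fun h => by
    have := N.kind.ultra h
    exact ⟨fun x y z => IsUltrametricDist.dist_triangle_max (x : N) y z⟩⟩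
  exists_smul_bound :=
    let ⟨C, hC⟩ := N.exists_smul_bound
    ⟨C, fun a x => hC a (x : N)⟩

/-- The factorization of a morphism through a kernel. -/
def BanHom.codRestrictKer (g : BanHom N T) (f : BanHom M N) (h : ∀ x, g (f x) = 0) :
    BanHom M (BanMod.ker g) where
  toLinearMap := f.toLinearMap.codRestrict _ h
  exists_bound :=
    let ⟨C, hC⟩ := f.exists_bound
    ⟨C, fun x => hC x⟩

/-- Exactness makes `f` surjective onto `ker g`, which is again a Banach module, and the constant
witnessing strictness of `f` still works there. Projectivity is then applied to the strict
epimorphism `M → ker g`. -/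
theorem BanMod.IsProjective.exists_lift {Q : BanMod 𝒞 A} (hQ : Q.IsProjective)
    {f : BanHom M N} {g : BanHom N T} (hfg : StrictExactAt f g) (h : BanHom Q N)
    (hh : ∀ x, g (h x) = 0) : ∃ k : BanHom Q M, f.comp k = h := by
  have hsurj : Function.Surjective (g.codRestrictKer f hfg.comp_apply) := by
    rintro ⟨y, hy⟩
    have hy' : y ∈ Set.range f := by
      rw [hfg.range_eq]
      exact hy
    obtain ⟨x, rfl⟩ := hy'
    exact ⟨x, rfl⟩
  obtain ⟨C, hC⟩ := hfg.2.2
  obtain ⟨k, hk⟩ := hQ _ _ (g.codRestrictKer f hfg.comp_apply) hsurj.denseRange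
    ⟨by rw [hsurj.range_eq]; exact isClosed_univ, C, fun x => by
      obtain ⟨x', h1, h2⟩ := hC x
      exact ⟨x', Subtype.ext h1, h2⟩⟩ (g.codRestrictKer h hh)
  exact ⟨k, BanHom.ext fun x => congrArg Subtype.val (DFunLike.congr_fun hk x)⟩

end Basic

/-! ### Contractions of augmented complexes -/

namespace BanComplex

variable {𝒞 : BanachKind} {A : Type u} [BanachRing A]

/-- A contracting homotopy of the augmented complex `⋯ → K_1 → K_0 → M → 0`. -/
structure Contraction (K : BanComplex 𝒞 A) {M : BanMod 𝒞 A} (ε : BanHom (K.X 0) M) where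
  aug_d : ε.comp (K.d 0) = 0
  σ : BanHom M (K.X 0)
  s : ∀ n, BanHom (K.X n) (K.X (n + 1))
  aug_σ : ε.comp σ = BanHom.id M
  zero_eq : σ.comp ε + (K.d 0).comp (s 0) = BanHom.id (K.X 0)
  succ_eq : ∀ n, (s n).comp (K.d n) + (K.d (n + 1)).comp (s (n + 1)) = BanHom.id (K.X (n + 1))

namespace Contraction

variable {K : BanComplex 𝒞 A} {M : BanMod 𝒞 A} {ε : BanHom (K.X 0) M}

theorem zero_apply (c : K.Contraction ε) (x : K.X 0) : c.σ (ε x) + K.d 0 (c.s 0 x) = x :=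
  DFunLike.congr_fun c.zero_eq x

theorem succ_apply (c : K.Contraction ε) (n : ℕ) (x : K.X (n + 1)) :
    c.s n (K.d n x) + K.d (n + 1) (c.s (n + 1) x) = x :=
  DFunLike.congr_fun (c.succ_eq n) x

theorem aug_σ_apply (c : K.Contraction ε) (x : M) : ε (c.σ x) = x :=
  DFunLike.congr_fun c.aug_σ x

theorem aug_d_apply (c : K.Contraction ε) (x : K.X 1) : ε (K.d 0 x) = 0 :=
  DFunLike.congr_fun c.aug_d x

/-- On cycles the homotopy identities lose one summand, so `σ` and the `s n` are bounded operators
giving preimages of cycles. -/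
theorem isQuasiIsoTo (c : K.Contraction ε) : K.IsQuasiIsoTo ε := by
  refine ⟨strictExactAt_of_operator (fun _ => rfl) c.σ fun y _ => c.aug_σ_apply y,
    strictExactAt_of_operator c.aug_d_apply (c.s 0) fun y hy => ?_, fun n =>
    strictExactAt_of_operator (fun x => DFunLike.congr_fun (K.d_comp_d n) x) (c.s (n + 1))
      fun y hy => ?_⟩
  · have := c.zero_apply y
    rwa [hy, map_zero, zero_add] at this
  · have := c.succ_apply n y
    rwa [hy, map_zero, zero_add] at this

/-- Transport of a contraction along an isomorphism of the augmentation targets. -/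
def trans (c : K.Contraction ε) {N : BanMod 𝒞 A} (f : BanHom M N) (g : BanHom N M)
    (hfg : f.comp g = BanHom.id N) (hgf : g.comp f = BanHom.id M) :
    K.Contraction (f.comp ε) where
  aug_d := by rw [BanHom.comp_assoc, c.aug_d, BanHom.comp_zero]
  σ := c.σ.comp g
  s := c.s
  aug_σ := by
    rw [BanHom.comp_assoc, ← BanHom.comp_assoc ε, c.aug_σ, BanHom.id_comp, hfg]
  zero_eq := by
    rw [BanHom.comp_assoc, ← BanHom.comp_assoc g, hgf, BanHom.id_comp, c.zero_eq]
  succ_eq := c.succ_eq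

end Contraction

end BanComplex

namespace BanResolution

variable {𝒞 : BanachKind} {A : Type u} [BanachRing A] {M : BanMod 𝒞 A}

/-- A projective resolution of a projective module is contractible. -/
theorem nonempty_contraction (P : BanResolution M) (hM : M.IsProjective) :
    Nonempty (P.P.Contraction P.aug) := by
  obtain ⟨hε, h0, hn⟩ := P.quasiIso
  obtain ⟨σ, hσ⟩ := hM.exists_lift hε (BanHom.id M) fun _ => rfl
  have hσ' : ∀ x, P.aug (σ x) = x := DFunLike.congr_fun hσ
  obtain ⟨s₀, hs₀⟩ := (P.projective 0).exists_lift h0 (BanHom.id _ - σ.comp P.aug) fun x => by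
    rw [BanHom.sub_apply, map_sub, BanHom.comp_apply, hσ', BanHom.id_apply, sub_self]
  have hs₀' : ∀ x, P.P.d 0 (s₀ x) = x - σ (P.aug x) := fun x => by
    rw [← BanHom.comp_apply, hs₀, BanHom.sub_apply, BanHom.comp_apply, BanHom.id_apply]
  -- The invariant `d s d = d` says that `id - s d` has values in the kernel of `d`, which is what
  -- the next lift requires. It is carried along in the recursion.
  let Q : ∀ n, BanHom (P.P.X n) (P.P.X (n + 1)) → Prop := fun n s =>
    ∀ x, P.P.d n (s (P.P.d n x)) = P.P.d n x
  have step : ∀ n (s : {s // Q n s}), ∃ t : {t // Q (n + 1) t},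
      ∀ x, s.1 (P.P.d n x) + P.P.d (n + 1) (t.1 x) = x := by
    rintro n ⟨s, hs⟩
    obtain ⟨t, ht⟩ := (P.projective (n + 1)).exists_lift (hn n)
      (BanHom.id _ - s.comp (P.P.d n)) fun x => by
        rw [BanHom.sub_apply, map_sub, BanHom.comp_apply, hs, BanHom.id_apply, sub_self]
    have ht' : ∀ x, P.P.d (n + 1) (t x) = x - s (P.P.d n x) := fun x => by
      rw [← BanHom.comp_apply, ht, BanHom.sub_apply, BanHom.comp_apply, BanHom.id_apply]
    refine ⟨⟨t, fun x => ?_⟩, fun x => ?_⟩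
    · rw [ht', (hn n).comp_apply, map_zero, sub_zero]
    · change s _ + P.P.d (n + 1) (t x) = x
      rw [ht', add_sub_cancel]
  choose next hnext using step
  let s : ∀ n, {s // Q n s} := fun n => Nat.rec ⟨s₀, fun x => by
    rw [hs₀', h0.comp_apply, map_zero, sub_zero]⟩ next n
  exact ⟨{
    aug_d := BanHom.ext h0.comp_apply
    σ := σ
    s := fun n => (s n).1
    aug_σ := hσ
    zero_eq := BanHom.ext fun x => by
      change σ (P.aug x) + P.P.d 0 (s₀ x) = x
      rw [hs₀', add_sub_cancel]
    succ_eq := fun n => BanHom.ext fun x => hnext n (s n) x }⟩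

end BanResolution

/-! ### Contractions of tensor products -/

section TensorMap

variable {𝒞 : BanachKind} {A : Type u} [BanachRing A] {M N M' N' : BanMod 𝒞 A}

theorem BanHom.add_tensorMap (f f' : BanHom M M') (g : BanHom N N') :
    (f + f').tensorMap g = f.tensorMap g + f'.tensorMap g :=
  BanMod.tensor_hom_ext fun m n => by
    simp only [BanHom.tensorMap_tmul, BanHom.add_apply, map_add, LinearMap.add_apply]

theorem BanHom.tensorMap_add (f : BanHom M M') (g g' : BanHom N N') :
    f.tensorMap (g + g') = f.tensorMap g + f.tensorMap g' :=
  BanMod.tensor_hom_ext fun m n => by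
    simp only [BanHom.tensorMap_tmul, BanHom.add_apply, map_add]

theorem BanHom.id_tensorMap_id :
    (BanHom.id M).tensorMap (BanHom.id N) = BanHom.id (M.tensor N) :=
  BanMod.tensor_hom_ext fun m n => by
    simp only [BanHom.tensorMap_tmul, BanHom.id_apply]

/-- This has the shape of one component of the total differential, stated for arbitrary morphisms so
that it can be evaluated without rewriting under the product types. -/
theorem BanHom.comp_add_zsmul_comp_apply {W T : BanMod 𝒞 A} (f : BanHom M T) (a : BanHom W M)
    (k : ℤ) (g : BanHom N T) (b : BanHom W N) (x : W) :
    (f.comp a + k • g.comp b) x = f (a x) + k • g (b x) := by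
  rw [BanHom.add_apply, BanHom.zsmul_apply]
  rfl

end TensorMap

namespace BanComplex

variable {𝒞 : BanachKind} {A : Type u} [BanachRing A]

theorem tot_d_apply (P Q : BanComplex 𝒞 A) (n : ℕ) (x : (P.tot Q).X (n + 1)) (i j : ℕ)
    (h : i + j = n) :
    ((P.tot Q).d n x : ∀ p : TotIdx n, (P.X p.1.1).tensor (Q.X p.1.2)) ⟨(i, j), h⟩ =
      (P.d i).tensorMap (BanHom.id (Q.X j))
        ((x : ∀ p : TotIdx (n + 1), (P.X p.1.1).tensor (Q.X p.1.2))
          ⟨(i + 1, j), by simp only; omega⟩) +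
      (-1 : ℤ) ^ i • (BanHom.id (P.X i)).tensorMap (Q.d j)
        ((x : ∀ p : TotIdx (n + 1), (P.X p.1.1).tensor (Q.X p.1.2))
          ⟨(i, j + 1), by simp only; omega⟩) := by
  exact (DFunLike.congr_fun (proj_comp_totD P Q n ⟨(i, j), h⟩) x).trans
    (BanHom.comp_add_zsmul_comp_apply _ _ _ _ _ x)

variable {P Q : BanComplex 𝒞 A} {M N : BanMod 𝒞 A} {ε : BanHom (P.X 0) M} {η : BanHom (Q.X 0) N}

/-- The augmentation of the total complex. -/
noncomputable def totAug (ε : BanHom (P.X 0) M) (η : BanHom (Q.X 0) N) :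
    BanHom ((P.tot Q).X 0) (M.tensor N) :=
  (ε.tensorMap η).comp
    (BanMod.proj (fun p : TotIdx 0 => (P.X p.1.1).tensor (Q.X p.1.2)) ⟨(0, 0), rfl⟩)

namespace Contraction

/-- The homotopy `s ⊗ 1 + σε ⊗ t` on the total complex. -/
noncomputable def totS (c : P.Contraction ε) (c' : Q.Contraction η) (n : ℕ) :
    BanHom ((P.tot Q).X n) ((P.tot Q).X (n + 1)) :=
  BanMod.piLift fun p : TotIdx (n + 1) =>
    match p with
    -- This case cannot occur, since the total degree is `n + 1`. The summand `σε ⊗ t` lives only in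
    -- first degree `0`, so it needs no sign.
    | ⟨(0, 0), _⟩ => 0
    | ⟨(0, j + 1), h⟩ => ((c.σ.comp ε).tensorMap (c'.s j)).comp
        (BanMod.proj (fun p : TotIdx n => (P.X p.1.1).tensor (Q.X p.1.2))
          ⟨(0, j), by simp only at h ⊢; omega⟩)
    | ⟨(i + 1, j), h⟩ => ((c.s i).tensorMap (BanHom.id (Q.X j))).comp
        (BanMod.proj (fun p : TotIdx n => (P.X p.1.1).tensor (Q.X p.1.2))
          ⟨(i, j), by simp only at h ⊢; omega⟩)

theorem totS_zero_apply (c : P.Contraction ε) (c' : Q.Contraction η) (n : ℕ)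
    (x : (P.tot Q).X n) (j : ℕ) (h : 0 + (j + 1) = n + 1) :
    (totS c c' n x : ∀ p : TotIdx (n + 1), (P.X p.1.1).tensor (Q.X p.1.2)) ⟨(0, j + 1), h⟩ =
      (c.σ.comp ε).tensorMap (c'.s j)
        ((x : ∀ p : TotIdx n, (P.X p.1.1).tensor (Q.X p.1.2))
          ⟨(0, j), by simp only; omega⟩) := rfl

theorem totS_succ_apply (c : P.Contraction ε) (c' : Q.Contraction η) (n : ℕ)
    (x : (P.tot Q).X n) (i j : ℕ) (h : i + 1 + j = n + 1) :
    (totS c c' n x : ∀ p : TotIdx (n + 1), (P.X p.1.1).tensor (Q.X p.1.2)) ⟨(i + 1, j), h⟩ =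
      (c.s i).tensorMap (BanHom.id (Q.X j))
        ((x : ∀ p : TotIdx n, (P.X p.1.1).tensor (Q.X p.1.2))
          ⟨(i, j), by simp only; omega⟩) := rfl

/-- The tensor product of two contractions. -/
noncomputable def tot (c : P.Contraction ε) (c' : Q.Contraction η) :
    (P.tot Q).Contraction (totAug (P := P) (Q := Q) ε η) where
  aug_d := BanHom.ext fun x => by
    change ε.tensorMap η (((P.tot Q).d 0 x :
      ∀ p : TotIdx 0, (P.X p.1.1).tensor (Q.X p.1.2)) ⟨(0, 0), rfl⟩) = 0
    rw [tot_d_apply, map_add, map_zsmul, ← BanHom.comp_apply, ← BanHom.comp_apply,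
      BanHom.tensorMap_comp, BanHom.tensorMap_comp, c.aug_d, c'.aug_d, BanHom.zero_tensorMap,
      BanHom.tensorMap_zero, BanHom.zero_apply, BanHom.zero_apply, smul_zero, add_zero]
  σ := BanMod.piLift fun p : TotIdx 0 =>
    match p with
    | ⟨(0, 0), _⟩ => c.σ.tensorMap c'.σ
    | ⟨(0, _ + 1), _⟩ => 0
    | ⟨(_ + 1, _), _⟩ => 0
  s := totS c c'
  aug_σ := by
    change (ε.tensorMap η).comp (c.σ.tensorMap c'.σ) = _
    rw [BanHom.tensorMap_comp, c.aug_σ, c'.aug_σ, BanHom.id_tensorMap_id]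
  zero_eq := BanHom.ext fun x => by
    refine funext fun p : TotIdx 0 => ?_
    obtain ⟨⟨i, j⟩, h⟩ := p
    obtain rfl : i = 0 := by simp only at h; omega
    obtain rfl : j = 0 := by simp only at h; omega
    change (c.σ.tensorMap c'.σ) (ε.tensorMap η _) +
      ((P.tot Q).d 0 (totS c c' 0 x) :
        ∀ p : TotIdx 0, (P.X p.1.1).tensor (Q.X p.1.2)) ⟨(0, 0), h⟩ = _
    rw [tot_d_apply, totS_succ_apply, totS_zero_apply]
    -- The terms `σε ⊗ σ'η` and `σε ⊗ d t` add up to `σε ⊗ 1`, which together with `d s ⊗ 1` is the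
    -- identity.
    have key : (c.σ.tensorMap c'.σ).comp (ε.tensorMap η) +
        (((P.d 0).tensorMap (BanHom.id (Q.X 0))).comp ((c.s 0).tensorMap (BanHom.id (Q.X 0))) +
        ((BanHom.id (P.X 0)).tensorMap (Q.d 0)).comp ((c.σ.comp ε).tensorMap (c'.s 0))) =
        BanHom.id _ := by
      simp only [BanHom.tensorMap_comp, BanHom.id_comp]
      rw [add_left_comm, ← BanHom.tensorMap_add, c'.zero_eq, ← BanHom.add_tensorMap,
        add_comm, c.zero_eq, BanHom.id_tensorMap_id]
    rw [pow_zero, one_smul]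
    exact DFunLike.congr_fun key _
  succ_eq n := BanHom.ext fun x => by
    refine funext fun p : TotIdx (n + 1) => ?_
    obtain ⟨⟨i, j⟩, h⟩ := p
    change (totS c c' n ((P.tot Q).d n x) :
        ∀ p : TotIdx (n + 1), (P.X p.1.1).tensor (Q.X p.1.2)) ⟨(i, j), h⟩ +
      ((P.tot Q).d (n + 1) (totS c c' (n + 1) x) :
        ∀ p : TotIdx (n + 1), (P.X p.1.1).tensor (Q.X p.1.2)) ⟨(i, j), h⟩ = _
    rw [tot_d_apply, totS_succ_apply]
    cases i with
    | zero =>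
      cases j with
      | zero => simp at h
      | succ j =>
        rw [totS_zero_apply, totS_zero_apply, tot_d_apply, pow_zero, one_smul, one_smul, map_add]
        -- The mixed term dies because `ε d = 0`; the remaining three terms combine as in degree
        -- zero.
        have k1 : ((c.σ.comp ε).tensorMap (c'.s j)).comp
            ((P.d 0).tensorMap (BanHom.id (Q.X j))) = 0 := by
          rw [BanHom.tensorMap_comp, BanHom.comp_assoc, c.aug_d, BanHom.comp_zero,
            BanHom.zero_tensorMap]
        have k2 : ((c.σ.comp ε).tensorMap (c'.s j)).comp
              ((BanHom.id (P.X 0)).tensorMap (Q.d j)) +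
            (((P.d 0).tensorMap (BanHom.id (Q.X (j + 1)))).comp
              ((c.s 0).tensorMap (BanHom.id (Q.X (j + 1)))) +
            ((BanHom.id (P.X 0)).tensorMap (Q.d (j + 1))).comp
              ((c.σ.comp ε).tensorMap (c'.s (j + 1)))) = BanHom.id _ := by
          simp only [BanHom.tensorMap_comp, BanHom.id_comp, BanHom.comp_id]
          rw [add_left_comm, ← BanHom.tensorMap_add, c'.succ_eq, ← BanHom.add_tensorMap,
            add_comm (BanHom.comp _ _), c.zero_eq, BanHom.id_tensorMap_id]
        rw [← BanHom.comp_apply, k1, BanHom.zero_apply, zero_add]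
        exact DFunLike.congr_fun k2 _
    | succ i =>
      rw [totS_succ_apply, totS_succ_apply, tot_d_apply, map_add, map_zsmul, pow_succ,
        mul_neg_one, neg_smul]
      -- The two mixed terms `s ⊗ d` are equal and enter with the signs `(-1)^i` and `(-1)^(i+1)`,
      -- so they cancel.
      have k1 : ((BanHom.id (P.X (i + 1))).tensorMap (Q.d j)).comp
            ((c.s i).tensorMap (BanHom.id (Q.X (j + 1)))) =
          ((c.s i).tensorMap (BanHom.id (Q.X j))).comp
            ((BanHom.id (P.X i)).tensorMap (Q.d j)) := by
        simp only [BanHom.tensorMap_comp, BanHom.id_comp, BanHom.comp_id]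
      have k2 : ((c.s i).tensorMap (BanHom.id (Q.X j))).comp
            ((P.d i).tensorMap (BanHom.id (Q.X j))) +
          ((P.d (i + 1)).tensorMap (BanHom.id (Q.X j))).comp
            ((c.s (i + 1)).tensorMap (BanHom.id (Q.X j))) = BanHom.id _ := by
        simp only [BanHom.tensorMap_comp, BanHom.id_comp]
        rw [← BanHom.add_tensorMap, c.succ_eq, BanHom.id_tensorMap_id]
      have k1' := DFunLike.congr_fun k1
      simp only [BanHom.comp_apply] at k1'
      rw [k1', add_add_add_comm, add_neg_cancel, add_zero]
      exact DFunLike.congr_fun k2 _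

end Contraction

/-- The unit complex is contractible onto the regular module. -/
def unitContraction (𝒞 : BanachKind) (A : Type u) [BanachRing A] [IsOfKind 𝒞 A] :
    (unit 𝒞 A).Contraction (M := BanMod.regular 𝒞 A) (BanHom.id _) where
  aug_d := rfl
  σ := BanHom.id _
  s _ := 0
  aug_σ := rfl
  zero_eq := BanHom.ext fun x => add_zero x
  succ_eq _ := rfl

end BanComplex

/-! ### Contractions of iterated tensor products -/

section TensorList

variable {𝒞 : BanachKind} {A : Type u} [BanachRing A] [IsOfKind 𝒞 A] {ι : Type}

/-- The augmentation of a tensor product of augmented complexes. -/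
noncomputable def tensorListAug {P : ι → BanComplex 𝒞 A} {M : ι → BanMod 𝒞 A}
    (ε : ∀ i, BanHom ((P i).X 0) (M i)) :
    ∀ l : List ι, BanHom ((tensorListC P l).X 0) (tensorList M l)
  | [] => BanHom.id _
  | i :: l => BanComplex.totAug (P := P i) (Q := tensorListC P l) (ε i) (tensorListAug ε l)

/-- The contraction of a tensor product of contracted complexes. -/
noncomputable def tensorListContraction {P : ι → BanComplex 𝒞 A} {M : ι → BanMod 𝒞 A}
    {ε : ∀ i, BanHom ((P i).X 0) (M i)} (c : ∀ i, (P i).Contraction (ε i)) :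
    ∀ l : List ι, (tensorListC P l).Contraction (tensorListAug ε l)
  | [] => BanComplex.unitContraction 𝒞 A
  | i :: l => (c i).tot (tensorListContraction c l)

end TensorList

/-! ### Quotients by ideals generated by idempotents -/

section Idempotent

variable {𝒞 : BanachKind} {A : Type u} [BanachRing A] [IsOfKind 𝒞 A]

/-- The morphism `A → N`, `a ↦ a • n`. -/
def BanMod.smulHom (N : BanMod 𝒞 A) (n : N) : BanHom (BanMod.regular 𝒞 A) N where
  toLinearMap := LinearMap.toSpanSingleton A N n
  exists_bound :=
    let ⟨C, hC⟩ := N.exists_smul_bound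
    ⟨C * ‖n‖, fun a => (hC a n).trans_eq (mul_right_comm _ _ _)⟩

/-- The unit of `B` as an element of the underlying module. -/
def BanAlg.unitElt {A : Type u} [BanachRing A] (B : BanAlg 𝒞 A) : B.toMod := (1 : B)

/-- `B` is the quotient of `A` by the idempotent `e`, in the sense that `A → B` is onto, `e` acts
by `0`, and multiplication by `1 - e` factors through a bounded map `B → A`. -/
structure BanAlg.IsIdempotentQuotient (B : BanAlg 𝒞 A) (e : A) : Prop where
  exists_smul_unitElt : ∀ b : B.toMod, ∃ a : A, a • B.unitElt = b
  smul_eq_zero : ∀ b : B.toMod, e • b = 0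
  exists_section : ∃ π : BanHom B.toMod (BanMod.regular 𝒞 A), π B.unitElt = (1 - e : A)

/-- An element lies in `eA` exactly when `1 - e` kills it, and multiplication by `1 - e` is
continuous. The kind `arch` is used because it imposes no condition, closedness being independent of
the ambient category. -/
theorem isClosed_span_idempotent {A : Type u} [BanachRing A] {e : A} (he : IsIdempotentElem e) :
    IsClosed ((Ideal.span {e} : Ideal A) : Set A) := by
  have : IsOfKind .arch A := ⟨nofun⟩
  have h : ((Ideal.span {e} : Ideal A) : Set A) =
      {x : A | (BanMod.regular .arch A).smulHom (1 - e : A) x = (0 : A)} := by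
    ext x
    rw [SetLike.mem_coe, Ideal.mem_span_singleton']
    change _ ↔ x * (1 - e) = 0
    constructor
    · rintro ⟨a, rfl⟩
      rw [mul_assoc, mul_sub, mul_one, he.eq, sub_self, mul_zero]
    · intro hx
      exact ⟨x, by linear_combination -hx⟩
  rw [h]
  exact isClosed_eq (BanHom.continuous _) continuous_const

/-- Multiplication by `1 - e` kills `eA`, so it descends to the quotient; this is the bounded
section. -/
theorem BanAlg.quotient_isIdempotentQuotient {e : A} (he : IsIdempotentElem e)
    (h : IsClosed ((Ideal.span {e} : Ideal A) : Set A)) :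
    (BanAlg.quotient 𝒞 (Ideal.span {e}) h).IsIdempotentQuotient e := by
  have hker : (Ideal.span {e} : Ideal A) ≤ LinearMap.ker (LinearMap.mulLeft A (1 - e)) := by
    rw [Ideal.span_le]
    rintro x rfl
    change (1 - x) * x = 0
    rw [sub_mul, one_mul, he.eq, sub_self]
  refine ⟨fun b => ?_, fun b => ?_, ⟨⟨⟨⟨
    Submodule.liftQ (Ideal.span {e} : Ideal A) (LinearMap.mulLeft A (1 - e)) hker,
    fun x y => map_add _ x y⟩, fun a x => ?_⟩, ?_⟩, mul_one (1 - e)⟩⟩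
  · obtain ⟨a, rfl⟩ := Ideal.Quotient.mk_surjective b
    exact ⟨a, congrArg (Ideal.Quotient.mk (Ideal.span {e})) (mul_one a)⟩
  · obtain ⟨a, rfl⟩ := Ideal.Quotient.mk_surjective b
    change Ideal.Quotient.mk (Ideal.span {e}) (e * a) = 0
    exact Ideal.Quotient.eq_zero_iff_mem.2
      (Ideal.mul_mem_right _ _ (Ideal.mem_span_singleton_self e))
  · obtain ⟨b, rfl⟩ := Ideal.Quotient.mk_surjective x
    exact mul_left_comm (1 - e) a b
  · obtain ⟨C, hC⟩ := BanachRing.exists_mul_bound (R := A)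
    refine ⟨max C 0 * ‖1 - e‖, fun x => ?_⟩
    -- The quotient norm is an infimum over representatives, so the bound is proved with a
    -- representative of norm less than `‖x‖ + ε`, and then `ε` tends to `0`.
    have key : ∀ ε > 0, ‖Submodule.liftQ (Ideal.span {e} : Ideal A)
        (LinearMap.mulLeft A (1 - e)) hker x‖ ≤ max C 0 * ‖1 - e‖ * (‖x‖ + ε) := fun ε hε => by
      obtain ⟨y, rfl, hy⟩ := Submodule.Quotient.norm_mk_lt
        (S := (Ideal.span {e} : Ideal A)) x hε
      refine (hC (1 - e) y).trans ?_
      have h1 : max C 0 * ‖1 - e‖ * ‖y‖ ≤ max C 0 * ‖1 - e‖ * (‖(Submodule.Quotient.mk y :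
          A ⧸ (Ideal.span {e} : Ideal A))‖ + ε) := by gcongr
      refine le_trans ?_ h1
      gcongr
      exact le_max_left _ _
    have hc : Filter.Tendsto (fun ε : ℝ => max C 0 * ‖1 - e‖ * (‖x‖ + ε))
        (nhdsWithin 0 (Set.Ioi 0)) (nhds (max C 0 * ‖1 - e‖ * (‖x‖ + 0))) :=
      (Continuous.tendsto (by fun_prop) 0).mono_left nhdsWithin_le_nhds
    rw [add_zero] at hc
    exact ge_of_tendsto hc (Filter.eventually_of_mem self_mem_nhdsWithin key)

theorem BanMod.isProjective_zero {A : Type u} [BanachRing A] : (BanMod.zero 𝒞 A).IsProjective := fun _ _ _ _ _ f =>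
  ⟨0, BanHom.ext fun x => by
    rw [BanHom.comp_zero, BanHom.zero_apply, Subsingleton.elim (α := PUnit) x 0]
    exact (map_zero f).symm⟩

/-- The complex with `M` in degree `0`. -/
def BanComplex.single (M : BanMod 𝒞 A) : BanComplex 𝒞 A where
  X
    | 0 => M
    | _ + 1 => BanMod.zero 𝒞 A
  d _ := 0
  d_comp_d _ := rfl

/-- The trivial resolution of a projective module. -/
def BanResolution.single {M : BanMod 𝒞 A} (hM : M.IsProjective) : BanResolution M where
  P := BanComplex.single M
  projective
    | 0 => hM
    | _ + 1 => BanMod.isProjective_zero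
  aug := BanHom.id M
  quasiIso := BanComplex.Contraction.isQuasiIsoTo
    { aug_d := rfl
      σ := BanHom.id _
      s := fun _ => 0
      aug_σ := rfl
      zero_eq := BanHom.ext fun x => add_zero x
      succ_eq := fun _ => rfl }

theorem BanAlg.mul_comp_tmulLeft_unitElt {A : Type u} [BanachRing A] (B : BanAlg 𝒞 A) :
    B.mul.comp (BanMod.tmulLeft B.unitElt B.toMod) = BanHom.id B.toMod :=
  BanHom.ext fun b => (BanMod.tensorLift_tmul _ _ _ _).trans (one_mul (M := B) b)

namespace BanAlg.IsIdempotentQuotient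

variable {B : BanAlg 𝒞 A} {e : A}

/-- A morphism `f` out of `B` is determined by `f 1`. If `p n = f 1`, then `b ↦ π b • n` lifts `f`:
its composite with `p` takes `1` to `(1 - e) • f 1`, and this is `f 1` because `e` acts by zero on
`B`. -/
theorem isProjective (hB : B.IsIdempotentQuotient e) : B.toMod.IsProjective := by
  intro N T p hd hs f
  have hsurj : Function.Surjective p := by
    rw [← Set.range_eq_univ, ← hs.1.closure_eq]
    exact hd.closure_range
  obtain ⟨n, hn⟩ := hsurj (f B.unitElt)
  obtain ⟨π, hπ⟩ := hB.exists_section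
  refine ⟨(N.smulHom n).comp π, BanHom.ext fun b => ?_⟩
  obtain ⟨a, rfl⟩ := hB.exists_smul_unitElt b
  have h1 : N.smulHom n (π B.unitElt) = (1 - e) • n := by
    rw [hπ]
    rfl
  rw [map_smul, map_smul, BanHom.comp_apply, BanHom.comp_apply, h1, map_smul, hn, sub_smul,
    ← map_smul f e, hB.smul_eq_zero, map_zero, sub_zero, one_smul]

theorem isEpi (hB : B.IsIdempotentQuotient e) : B.IsEpi := fun D f g _ _ _ =>
  AlgHom.ext fun b => by
    obtain ⟨a, ha⟩ := hB.exists_smul_unitElt b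
    have ha' : a • (1 : B) = b := ha
    rw [← ha', map_smul, map_smul, map_one, map_one]

/-- Each element of `B` is some `a • 1`, and scalars move across the tensor sign, so every pure
tensor has the form `1 ⊗ c`. With `BanAlg.mul_comp_tmulLeft_unitElt`, which holds for all `B`, this
makes the multiplication an isomorphism. -/
theorem tmulLeft_unitElt_comp_mul (hB : B.IsIdempotentQuotient e) :
    (BanMod.tmulLeft B.unitElt B.toMod).comp B.mul = BanHom.id (B.toMod.tensor B.toMod) :=
  BanMod.tensor_hom_ext fun b c => by
    obtain ⟨a, rfl⟩ := hB.exists_smul_unitElt b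
    have h : B.mul (B.toMod.tmul B.toMod B.unitElt c) = c :=
      DFunLike.congr_fun B.mul_comp_tmulLeft_unitElt c
    rw [map_smul, LinearMap.smul_apply, map_smul, map_smul, BanHom.comp_apply, h]
    rfl

/-- Any two resolutions of the projective module `B` contract onto it, so `Tot(P ⊗̂ Q)` contracts
onto `B ⊗̂ B`; the contraction is then transported along the isomorphism `B ⊗̂ B ≅ B`. -/
theorem isHomotopyEpi (hB : B.IsIdempotentQuotient e) : B.IsHomotopyEpi := by
  refine ⟨⟨BanResolution.single hB.isProjective⟩, fun P Q => ?_⟩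
  obtain ⟨c⟩ := P.nonempty_contraction hB.isProjective
  obtain ⟨c'⟩ := Q.nonempty_contraction hB.isProjective
  exact ((c.tot c').trans B.mul _ B.mul_comp_tmulLeft_unitElt
    hB.tmulLeft_unitElt_comp_mul).isQuasiIsoTo

theorem nonempty_unitalResolution (hB : B.IsIdempotentQuotient e) :
    Nonempty B.UnitalResolution :=
  ⟨{ BanResolution.single hB.isProjective with
      one := (1 : B)
      aug_one := rfl }⟩

end BanAlg.IsIdempotentQuotient

/-- The closed ideal is determined by the quotient algebra. -/
theorem BanAlg.quotient_injective {I J : Ideal A} {hI : IsClosed (I : Set A)}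
    {hJ : IsClosed (J : Set A)} (h : BanAlg.quotient 𝒞 I hI = BanAlg.quotient 𝒞 J hJ) : I = J := by
  -- The kernel of the structure map depends on the algebra alone, so it transports along an
  -- equality of algebras.
  have hk : ∀ (I : Ideal A) (hI : IsClosed (I : Set A)),
      RingHom.ker (algebraMap A (BanAlg.quotient 𝒞 I hI)) = I := fun I _ => Ideal.mk_ker
  rw [← hk I hI, ← hk J hJ, h]

/-- An idempotent acts as a unit on the ideal it generates, whence `e f = e` and `f e = f`. -/
theorem IsIdempotentElem.span_singleton_injective {A : Type u} [CommRing A] {e f : A} (he : IsIdempotentElem e)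
    (hf : IsIdempotentElem f) (h : (Ideal.span {e} : Ideal A) = Ideal.span {f}) : e = f := by
  obtain ⟨a, ha⟩ := Ideal.mem_span_singleton'.1 (h ▸ Ideal.mem_span_singleton_self e)
  obtain ⟨b, hb⟩ := Ideal.mem_span_singleton'.1 (h.symm ▸ Ideal.mem_span_singleton_self f)
  have h1 : e * f = e := by rw [← ha, mul_assoc, hf.eq]
  have h2 : f * e = f := by rw [← hb, mul_assoc, he.eq]
  rw [← h1, mul_comm, h2]

end Idempotent

/-! ### The Tate–Čech complex -/

section Contract

variable {𝒞 : BanachKind} {A : Type u} [BanachRing A] [IsOfKind 𝒞 A]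

/-- The morphism `M ⊗̂ N → N`, `m ⊗ n ↦ φ m • n`. -/
noncomputable def BanMod.contract {M : BanMod 𝒞 A} (φ : BanHom M (BanMod.regular 𝒞 A))
    (N : BanMod 𝒞 A) : BanHom (M.tensor N) N :=
  BanMod.tensorLift ((LinearMap.lsmul A N).comp φ.toLinearMap) (by
    obtain ⟨C, hC, hφ⟩ := φ.bound
    obtain ⟨D, hD, hN⟩ := N.smul_bound
    refine ⟨D * C, fun m n => (hN (φ m) n).trans ?_⟩
    have h := mul_le_mul_of_nonneg_left (hφ m) hD
    calc D * ‖φ m‖ * ‖n‖ ≤ D * (C * ‖m‖) * ‖n‖ := mul_le_mul_of_nonneg_right h (norm_nonneg _)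
      _ = D * C * (‖m‖ * ‖n‖) := by ring)

theorem BanMod.contract_tmul {M N : BanMod 𝒞 A} (φ : BanHom M (BanMod.regular 𝒞 A))
    (m : M) (n : N) : BanMod.contract φ N (M.tmul N m n) = (show A from φ m) • n :=
  BanMod.tensorLift_tmul _ _ m n

theorem BanMod.contract_naturality {M N N' : BanMod 𝒞 A} (φ : BanHom M (BanMod.regular 𝒞 A))
    (f : BanHom N N') :
    (BanMod.contract φ N').comp ((BanHom.id M).tensorMap f) = f.comp (BanMod.contract φ N) :=
  BanMod.tensor_hom_ext fun m n => by
    rw [BanHom.comp_apply, BanHom.comp_apply, BanHom.tensorMap_tmul, BanMod.contract_tmul,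
      BanMod.contract_tmul, map_smul, BanHom.id_apply]

/-- Multiplication by a scalar. -/
def BanHom.scalar (N : BanMod 𝒞 A) (a : A) : BanHom N N where
  toLinearMap := LinearMap.lsmul A N a
  exists_bound :=
    let ⟨C, hC⟩ := N.exists_smul_bound
    ⟨C * ‖a‖, fun n => hC a n⟩

end Contract

section Cech

variable {𝒞 : BanachKind} {A : Type u} [BanachRing A] [IsOfKind 𝒞 A]

/-! ### The Čech differential on families indexed by all lists -/

section Fun

variable {ι : Type} (M : ι → BanMod 𝒞 A) (v : ∀ i, M i)

/-- The Tate–Čech differential on families indexed by all lists. -/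
noncomputable def cechFun (w : ∀ l, tensorList M l) (l : List ι) : tensorList M l :=
  ∑ j ∈ Finset.range l.length, (-1 : ℤ) ^ j • coface M v l j (w (l.eraseIdx j))

variable {M v}

/-- Insertion at the head is split off; the other insertions happen in the tail, one position later,
hence the minus sign. -/
theorem cechFun_cons (w : ∀ l, tensorList M l) (k : ι) (l : List ι) :
    cechFun M v w (k :: l) = BanMod.tmulLeft (v k) (tensorList M l) (w l) -
      ∑ j ∈ Finset.range l.length, (-1 : ℤ) ^ j •
        (BanHom.id (M k)).tensorMap (coface M v l j) (w (k :: l.eraseIdx j)) := by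
  rw [cechFun, List.length_cons, Finset.sum_range_succ', pow_zero, one_smul, add_comm,
    sub_eq_add_neg, ← Finset.sum_neg_distrib]
  refine congrArg₂ _ rfl (Finset.sum_congr rfl fun j _ => ?_)
  rw [pow_succ, mul_neg_one, neg_smul]
  rfl

theorem cechFun_sum {κ : Type*} (s : Finset κ) (w : κ → ∀ l, tensorList M l) (l : List ι) :
    cechFun M v (fun l => ∑ i ∈ s, w i l) l = ∑ i ∈ s, cechFun M v (w i) l := by
  simp only [cechFun, map_sum, Finset.smul_sum]
  exact Finset.sum_comm

theorem cechFun_congr {w w' : ∀ l, tensorList M l} {l : List ι}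
    (h : ∀ j < l.length, w (l.eraseIdx j) = w' (l.eraseIdx j)) :
    cechFun M v w l = cechFun M v w' l :=
  Finset.sum_congr rfl fun j hj => by rw [h j (Finset.mem_range.1 hj)]

end Fun

/-- An endofunctor of the category of Banach modules. -/
structure BanFunctor (𝒞 : BanachKind) (A : Type u) [BanachRing A] where
  obj : BanMod 𝒞 A → BanMod 𝒞 A
  map : ∀ {M N : BanMod 𝒞 A}, BanHom M N → BanHom (obj M) (obj N)
  map_comp : ∀ {M N T : BanMod 𝒞 A} (g : BanHom N T) (f : BanHom M N) (x : obj M),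
    map g (map f x) = map (g.comp f) x

/-- The functor `N ↦ F (M ⊗̂ N)`. -/
noncomputable def BanFunctor.compTensor {A : Type u} [BanachRing A] (F : BanFunctor 𝒞 A)
    (M : BanMod 𝒞 A) : BanFunctor 𝒞 A where
  obj N := F.obj (M.tensor N)
  map f := F.map ((BanHom.id M).tensorMap f)
  map_comp g f x := by rw [F.map_comp, BanHom.tensorMap_comp, BanHom.id_comp]

theorem BanMod.tmulLeft_naturality {A : Type u} [BanachRing A] {M N N' : BanMod 𝒞 A} (m : M)
    (f : BanHom N N') :
    ((BanHom.id M).tensorMap f).comp (BanMod.tmulLeft m N) = (BanMod.tmulLeft m N').comp f :=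
  BanHom.ext fun n => BanHom.tensorMap_tmul (BanHom.id M) f m n

/-- The bookkeeping behind `d² = 0`. The terms `a 0 j` cancel against `a (j + 1) 0`, whose sign is
opposite, and the remaining terms form the same sum with both indices shifted, where the two sign
changes cancel. The numbers `r j` and `r' j` stand for the lengths of a list and of its tail after
an erasure. -/
theorem sum_alternating_cancel {G : Type*} [AddCommGroup G] (n : ℕ) (r r' : ℕ → ℕ)
    (a : ℕ → ℕ → G) (hr₀ : r 0 = n) (hr : ∀ j, r (j + 1) = r' j + 1)
    (ha : ∀ j, a 0 j = a (j + 1) 0)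
    (h : ∑ j ∈ Finset.range n, ∑ i ∈ Finset.range (r' j),
      ((-1 : ℤ) ^ j * (-1 : ℤ) ^ i) • a (j + 1) (i + 1) = 0) :
    ∑ j ∈ Finset.range (n + 1), ∑ i ∈ Finset.range (r j),
      ((-1 : ℤ) ^ j * (-1 : ℤ) ^ i) • a j i = 0 := by
  have h1 : ∀ j, ∑ i ∈ Finset.range (r (j + 1)), ((-1 : ℤ) ^ (j + 1) * (-1 : ℤ) ^ i) •
      a (j + 1) i = ∑ i ∈ Finset.range (r' j), ((-1 : ℤ) ^ j * (-1 : ℤ) ^ i) •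
        a (j + 1) (i + 1) - (-1 : ℤ) ^ j • a 0 j := by
    intro j
    rw [hr, Finset.sum_range_succ', sub_eq_add_neg, ha, pow_zero, mul_one, ← neg_smul, pow_succ,
      mul_neg_one]
    simp only [pow_succ, mul_neg_one, neg_mul_neg]
  rw [Finset.sum_range_succ', Finset.sum_congr rfl fun j _ => h1 j, Finset.sum_sub_distrib, h,
    zero_sub, neg_add_eq_zero, hr₀]
  simp only [pow_zero, one_mul]

/-- The coface maps of `k :: l` beyond the first are `id ⊗ coface` for `l`, so the induction
hypothesis is needed after tensoring with `M k`; the functor `F` is there to provide this. The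
cancelling pairs agree because inserting `v k` at the head commutes with insertions in the tail. -/
theorem BanFunctor.sum_coface_coface {ι : Type} (M : ι → BanMod 𝒞 A) (v : ∀ i, M i)
    (l : List ι) (F : BanFunctor 𝒞 A) (x : ∀ l, F.obj (tensorList M l)) :
    ∑ j ∈ Finset.range l.length, ∑ i ∈ Finset.range (l.eraseIdx j).length,
      ((-1 : ℤ) ^ j * (-1 : ℤ) ^ i) • F.map (coface M v l j)
        (F.map (coface M v (l.eraseIdx j) i) (x ((l.eraseIdx j).eraseIdx i))) = 0 := by
  induction l generalizing F with
  | nil => rfl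
  | cons k l ih =>
    refine sum_alternating_cancel (G := F.obj (tensorList M (k :: l))) l.length _
      (fun j => (l.eraseIdx j).length) (fun j i => F.map (coface M v (k :: l) j)
        (F.map (coface M v ((k :: l).eraseIdx j) i) (x (((k :: l).eraseIdx j).eraseIdx i))))
      rfl (fun _ => rfl) (fun j => ?_) (ih (F.compTensor (M k)) fun l => x (k :: l))
    rw [F.map_comp, F.map_comp]
    exact DFunLike.congr_fun
      (congrArg F.map (BanMod.tmulLeft_naturality (v k) (coface M v l j)).symm) _

theorem cechFun_cechFun {ι : Type} {M : ι → BanMod 𝒞 A} {v : ∀ i, M i}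
    (w : ∀ l, tensorList M l) (l : List ι) : cechFun M v (cechFun M v w) l = 0 := by
  have h := BanFunctor.sum_coface_coface M v l
    { obj := fun M => M
      map := fun f => f
      map_comp := fun _ _ _ => rfl } w
  simp only [mul_smul] at h
  simp only [cechFun, map_sum, map_zsmul, Finset.smul_sum]
  exact h

/-- Functionals `φ i` on modules `M i` with distinguished elements `v i` which, together, split the
Tate–Čech complex. -/
structure CechSplitting {m : ℕ} (M : Fin m → BanMod 𝒞 A) (v : ∀ i, M i) where
  φ : ∀ i, BanHom (M i) (BanMod.regular 𝒞 A)
  weight : Fin m → A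
  φ_v : ∀ i, φ i (v i) = weight i
  φ_smul_v : ∀ i (b : M i), (show A from φ i b) • v i = weight i • b
  φ_smul_of_lt : ∀ i k, k < i → ∀ (b : M i) (c : M k), (show A from φ i b) • c = 0
  sum_weight : ∑ i, weight i = 1

namespace CechSplitting

variable {m : ℕ} {M : Fin m → BanMod 𝒞 A} {v : ∀ i, M i} (S : CechSplitting M v)

theorem contract_tmulLeft (i : Fin m) (N : BanMod 𝒞 A) (n : N) :
    BanMod.contract (S.φ i) N (BanMod.tmulLeft (v i) N n) = S.weight i • n := by
  refine (BanMod.contract_tmul _ _ _).trans ?_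
  rw [S.φ_v]

theorem tmulLeft_contract (i : Fin m) (N : BanMod 𝒞 A) (x : (M i).tensor N) :
    BanMod.tmulLeft (v i) N (BanMod.contract (S.φ i) N x) = S.weight i • x := by
  have h : (BanMod.tmulLeft (v i) N).comp (BanMod.contract (S.φ i) N) =
      BanHom.scalar _ (S.weight i) := BanMod.tensor_hom_ext fun b n => by
    rw [BanHom.comp_apply, BanMod.contract_tmul, map_smul]
    change _ • (M i).tmul N (v i) n = S.weight i • (M i).tmul N b n
    rw [← LinearMap.smul_apply, ← map_smul, S.φ_smul_v, map_smul, LinearMap.smul_apply]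
  exact DFunLike.congr_fun h x

theorem tmulLeft_contract_of_lt {i k : Fin m} (hk : k < i) (N : BanMod 𝒞 A)
    (x : (M i).tensor N) : BanMod.tmulLeft (v k) N (BanMod.contract (S.φ i) N x) = 0 := by
  have h : (BanMod.tmulLeft (v k) N).comp (BanMod.contract (S.φ i) N) = 0 :=
    BanMod.tensor_hom_ext fun b n => by
      rw [BanHom.comp_apply, BanMod.contract_tmul, map_smul]
      change _ • (M k).tmul N (v k) n = 0
      rw [← LinearMap.smul_apply, ← map_smul, S.φ_smul_of_lt i k hk, map_zero,
        LinearMap.zero_apply]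
  exact DFunLike.congr_fun h x

theorem weight_smul_of_lt {i k : Fin m} (hk : k < i) (N : BanMod 𝒞 A) (x : (M k).tensor N) :
    S.weight i • x = 0 := by
  have h : BanHom.scalar ((M k).tensor N) (S.weight i) = 0 :=
    BanMod.tensor_hom_ext fun b n => by
      change S.weight i • (M k).tmul N b n = 0
      have := S.φ_smul_of_lt i k hk (v i) b
      rw [S.φ_v] at this
      rw [← LinearMap.smul_apply, ← map_smul, this, map_zero, LinearMap.zero_apply]
  exact DFunLike.congr_fun h x

/-- The part of index `i` of the homotopy. -/
noncomputable def part (w : ∀ l, tensorList M l) (i : Fin m) (l : List (Fin m)) :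
    tensorList M l :=
  if (i :: l).Pairwise (· < ·) then BanMod.contract (S.φ i) (tensorList M l) (w (i :: l)) else 0

/-- This is the heart of the acyclicity. If `i` precedes all of `l`, contract the cocycle condition
at `i :: l` with `φ i`. Otherwise `i` is at least the head `k` of `l`, and only the insertion of `v
k` at the head can contribute: it gives the weight when `i = k`, and both sides vanish when `k < i`.
-/
theorem cechFun_part (w : ∀ l, tensorList M l) (i : Fin m) {l : List (Fin m)}
    (hl : l.Pairwise (· < ·))
    (hw : ∀ i, (i :: l).Pairwise (· < ·) → cechFun M v w (i :: l) = 0) :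
    cechFun M v (S.part w i) l = S.weight i • w l := by
  by_cases hi : (i :: l).Pairwise (· < ·)
  -- The cocycle condition at `i :: l` expresses `v i ⊗ w l` through the values of `w` at lists `i
  -- :: l.eraseIdx j`.
  · have h := sub_eq_zero.1 ((cechFun_cons w i l).symm.trans (hw i hi))
    rw [← S.contract_tmulLeft i _ (w l), h, map_sum, cechFun]
    refine Finset.sum_congr rfl fun j _ => ?_
    rw [map_zsmul, part, if_pos (hi.sublist ((List.eraseIdx_sublist l j).cons_cons i))]
    exact congrArg _ (DFunLike.congr_fun
      (BanMod.contract_naturality (S.φ i) (coface M v l j)) (w (i :: l.eraseIdx j))).symm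
  · cases l with
    | nil => exact absurd (List.pairwise_singleton _ _) hi
    | cons k l =>
      have hik : ∀ l', ¬ (i :: k :: l').Pairwise (· < ·) := by
        intro l' h'
        have hlt : i < k := (List.pairwise_cons.1 h').1 k List.mem_cons_self
        refine hi (List.pairwise_cons.2 ⟨fun a ha => ?_, hl⟩)
        rcases List.mem_cons.1 ha with rfl | ha
        · exact hlt
        · exact hlt.trans ((List.pairwise_cons.1 hl).1 a ha)
      have hki : k ≤ i := by
        by_contra h
        refine hik [] ?_
        simpa using h
      -- Erasing an entry of the tail keeps `k` at the head, and no list starting with `i, k` is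
      -- increasing, so all these terms are zero.
      rw [cechFun_cons, Finset.sum_eq_zero, sub_zero]
      · rcases hki.lt_or_eq with hlt | rfl
        · refine Eq.trans ?_ (S.weight_smul_of_lt hlt _ (w (k :: l))).symm
          rw [part]
          split_ifs
          · exact S.tmulLeft_contract_of_lt hlt _ _
          · exact map_zero _
        · rw [part, if_pos hl]
          exact S.tmulLeft_contract k _ _
      · intro j _
        rw [part, if_neg (hik _)]
        exact (congrArg _ (map_zero _)).trans (smul_zero _)

/-- The homotopy. -/
noncomputable def homotopy (w : ∀ l, tensorList M l) (l : List (Fin m)) : tensorList M l :=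
  ∑ i, S.part w i l

/-- The parts contribute `weight i • w l`, and the weights add up to `1`. -/
theorem cechFun_homotopy (w : ∀ l, tensorList M l) {l : List (Fin m)}
    (hl : l.Pairwise (· < ·))
    (hw : ∀ i, (i :: l).Pairwise (· < ·) → cechFun M v w (i :: l) = 0) :
    cechFun M v (S.homotopy w) l = w l := by
  refine (cechFun_sum _ _ _).trans ?_
  rw [Finset.sum_congr rfl fun i _ => S.cechFun_part w i hl hw, ← Finset.sum_smul,
    S.sum_weight, one_smul]

end CechSplitting

/-! ### Acyclicity of the non-derived Tate–Čech complex -/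

section Acyclic

variable {m : ℕ} {B : Fin m → BanAlg 𝒞 A}

open Classical in
/-- The extension by zero of a Tate–Čech cochain to all lists. -/
noncomputable def cechExt {p : ℕ} (x : cechX B p) (l : List (Fin m)) :
    tensorList (fun i => (B i).toMod) l :=
  if h : l.Pairwise (· < ·) ∧ l.length = p then
    (x : ∀ l : CechIdx m p, tensorList (fun i => (B i).toMod) l.1) ⟨l, h⟩ else 0

theorem cechExt_apply {p : ℕ} (x : cechX B p) (l : CechIdx m p) :
    cechExt x l.1 = (x : ∀ l : CechIdx m p, tensorList (fun i => (B i).toMod) l.1) l :=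
  dif_pos l.2

theorem cechD_apply {p : ℕ} (x : cechX B p) (l : CechIdx m (p + 1)) :
    (cechD B p x : ∀ l : CechIdx m (p + 1), tensorList (fun i => (B i).toMod) l.1) l =
      cechFun (fun i => (B i).toMod) (fun i => (B i).unitElt) (cechExt x) l.1 := by
  refine (BanHom.sum_apply _ _ _).trans ?_
  rw [cechFun, Finset.sum_range]
  refine Finset.sum_congr rfl fun j _ => ?_
  refine (BanHom.zsmul_apply _ _ _).trans ?_
  refine congrArg _ (congrArg (coface _ _ l.1 j) ?_)
  exact (cechExt_apply x ⟨l.1.eraseIdx j, l.2.1.sublist (List.eraseIdx_sublist _ _), by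
          rw [List.length_eraseIdx_of_lt j.2, l.2.2, Nat.add_sub_cancel]⟩).symm

/-- Restricted to increasing lists because extension by zero does not in general respect the
differential elsewhere, for instance at `[j, i]` with `i < j`. -/
theorem cechExt_cechD {p : ℕ} (x : cechX B p) {l : List (Fin m)} (hl : l.Pairwise (· < ·))
    (hp : l.length = p + 1) : cechExt (cechD B p x) l =
      cechFun (fun i => (B i).toMod) (fun i => (B i).unitElt) (cechExt x) l :=
  (cechExt_apply (cechD B p x) ⟨l, hl, hp⟩).trans (cechD_apply x _)

theorem cechD_cechD {p : ℕ} (x : cechX B p) : cechD B (p + 1) (cechD B p x) = 0 := by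
  refine funext fun l : CechIdx m (p + 2) => (cechD_apply _ l).trans ?_
  refine (cechFun_congr fun j hj => ?_).trans (cechFun_cechFun (cechExt x) l.1)
  refine cechExt_cechD x (l.2.1.sublist (List.eraseIdx_sublist _ _)) ?_
  rw [List.length_eraseIdx_of_lt hj, l.2.2]
  rfl

theorem cechFun_cechExt_eq_zero {p : ℕ} {x : cechX B p} (hx : cechD B p x = 0)
    {l : List (Fin m)} (hl : l.Pairwise (· < ·)) (hp : l.length = p + 1) :
    cechFun (fun i => (B i).toMod) (fun i => (B i).unitElt) (cechExt x) l = 0 := by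
  rw [← cechExt_cechD x hl hp, hx]
  exact cechExt_apply 0 ⟨l, hl, hp⟩

open Classical in
/-- The contracting operator of the Tate–Čech complex. -/
noncomputable def CechSplitting.operator
    (S : CechSplitting (fun i => (B i).toMod) (fun i => (B i).unitElt)) (p : ℕ) :
    BanHom (cechX B (p + 1)) (cechX B p) :=
  BanMod.piLift fun l : CechIdx m p => ∑ i,
    if h : (i :: l.1).Pairwise (· < ·) then
      (BanMod.contract (S.φ i) (tensorList (fun i => (B i).toMod) l.1)).comp
        (BanMod.proj (fun l : CechIdx m (p + 1) => tensorList (fun i => (B i).toMod) l.1)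
          ⟨i :: l.1, h, congrArg (· + 1) l.2.2⟩)
    else 0

theorem CechSplitting.operator_apply
    (S : CechSplitting (fun i => (B i).toMod) (fun i => (B i).unitElt)) {p : ℕ}
    (x : cechX B (p + 1)) (l : CechIdx m p) :
    (S.operator p x : ∀ l : CechIdx m p, tensorList (fun i => (B i).toMod) l.1) l =
      S.homotopy (cechExt x) l.1 := by
  refine (BanHom.sum_apply _ _ _).trans (Finset.sum_congr rfl fun i _ => ?_)
  rw [part]
  split_ifs with h
  · exact congrArg _ (cechExt_apply x ⟨i :: l.1, h, congrArg (· + 1) l.2.2⟩).symm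
  · rfl

theorem CechSplitting.tateAcyclic
    (S : CechSplitting (fun i => (B i).toMod) (fun i => (B i).unitElt)) : TateAcyclic B := by
  refine ⟨strictExactAt_of_exists_bound (fun _ => map_zero _) ⟨0, fun y hy => ⟨0, ?_, ?_⟩⟩,
    fun p => strictExactAt_of_operator cechD_cechD (S.operator p) fun y hy => ?_⟩
  · refine funext fun l : CechIdx m 0 => Eq.symm ?_
    obtain ⟨l, hl, h0⟩ := l
    obtain rfl := List.length_eq_zero_iff.1 h0
    -- At the empty list the differential is an empty sum, so this identity says that `y` is zero.
    have h := S.cechFun_homotopy (cechExt y) hl fun i hi => cechFun_cechExt_eq_zero hy hi rfl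
    exact (cechExt_apply y _).symm.trans h.symm
  · rw [norm_zero, zero_mul]
  · refine funext fun l : CechIdx m (p + 1) => (cechD_apply _ l).trans ?_
    refine Eq.trans ?_ ((S.cechFun_homotopy (cechExt y) l.2.1 fun i hi =>
      cechFun_cechExt_eq_zero hy hi (congrArg (· + 1) l.2.2)).trans (cechExt_apply y l))
    refine cechFun_congr fun j hj => ?_
    have h2 : (l.1.eraseIdx j).length = p := by
      rw [List.length_eraseIdx_of_lt hj, l.2.2, Nat.add_sub_cancel]
    exact (cechExt_apply _ ⟨l.1.eraseIdx j, l.2.1.sublist (List.eraseIdx_sublist _ _), h2⟩).trans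
      (S.operator_apply y _)

end Acyclic

end Cech

/-! ### The derived Tate–Čech complex -/

namespace BanComplex

variable {𝒞 : BanachKind} {A : Type u} [BanachRing A]

theorem castX_naturality {K K' : BanComplex 𝒞 A} (f : ∀ q, BanHom (K.X q) (K'.X q)) {n k : ℕ}
    (h : n = k) (x : K.X n) : f k (K.castX h x) = K'.castX h (f n x) := by
  subst h
  rfl

theorem castX_d (K : BanComplex 𝒞 A) {n k : ℕ} (h : n = k) (h' : n + 1 = k + 1)
    (x : K.X (n + 1)) : K.d k (K.castX h' x) = K.castX h (K.d n x) := by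
  subst h
  rfl

/-- The map of graded modules `P ⊗̂ Y → P ⊗̂ Z` induced by a map of graded modules `Y → Z`. -/
noncomputable def totMap (P : BanComplex 𝒞 A) {Y Z : ℕ → BanMod 𝒞 A}
    (f : ∀ q, BanHom (Y q) (Z q)) (q : ℕ) :
    BanHom (BanMod.pi fun p : TotIdx q => (P.X p.1.1).tensor (Y p.1.2))
      (BanMod.pi fun p : TotIdx q => (P.X p.1.1).tensor (Z p.1.2)) :=
  BanMod.piLift fun p => ((BanHom.id (P.X p.1.1)).tensorMap (f p.1.2)).comp
    (BanMod.proj (fun p : TotIdx q => (P.X p.1.1).tensor (Y p.1.2)) p)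

end BanComplex

/-! ### Coface maps of tensor products of complexes -/

section Coface

variable {𝒞 : BanachKind} {A : Type u} [BanachRing A]

/-- A functor from graded Banach modules to Banach modules. -/
structure GradedBanFunctor (𝒞 : BanachKind) (A : Type u) [BanachRing A] where
  obj : (ℕ → BanMod 𝒞 A) → BanMod 𝒞 A
  map : ∀ {Y Z : ℕ → BanMod 𝒞 A}, (∀ q, BanHom (Y q) (Z q)) → BanHom (obj Y) (obj Z)
  map_comp : ∀ {Y Z W : ℕ → BanMod 𝒞 A} (g : ∀ q, BanHom (Z q) (W q))
    (f : ∀ q, BanHom (Y q) (Z q)) (x : obj Y),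
    map g (map f x) = map (fun q => (g q).comp (f q)) x

/-- The functor `Y ↦ F (P ⊗̂ Y)`. -/
noncomputable def GradedBanFunctor.compTot (F : GradedBanFunctor 𝒞 A) (P : BanComplex 𝒞 A) :
    GradedBanFunctor 𝒞 A where
  obj Y := F.obj fun q => BanMod.pi fun p : BanComplex.TotIdx q => (P.X p.1.1).tensor (Y p.1.2)
  map f := F.map (P.totMap f)
  map_comp g f x := by
    rw [F.map_comp]
    refine DFunLike.congr_fun (congrArg F.map ?_) x
    funext q
    refine BanMod.pi_hom_ext fun p => BanHom.ext fun y => ?_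
    refine (DFunLike.congr_fun (BanHom.tensorMap_comp (BanHom.id (P.X p.1.1)) (f p.1.2)
      (BanHom.id (P.X p.1.1)) (g p.1.2)) _)

variable [IsOfKind 𝒞 A] {ι : Type} (P : ι → BanComplex 𝒞 A) (e : ∀ i, (P i).X 0)

theorem cofaceC_zero_naturality (i : ι) {l l' : List ι}
    (f : ∀ q, BanHom ((tensorListC P l).X q) ((tensorListC P l').X q)) (q : ℕ) :
    ((P i).totMap f q).comp (cofaceC P e (i :: l) 0 q) =
      (cofaceC P e (i :: l') 0 q).comp (f q) := by
  refine BanMod.pi_hom_ext fun p => BanHom.ext fun x => ?_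
  obtain ⟨⟨a, b⟩, h⟩ := p
  cases a with
  | zero =>
    refine (BanHom.tensorMap_tmul _ _ _ _).trans ?_
    exact congrArg (((P i).X 0).tmul ((tensorListC P l').X b) (e i))
      (BanComplex.castX_naturality f _ x)
  | succ a => exact map_zero ((BanHom.id ((P i).X (a + 1))).tensorMap (f b))

/-- The same cancellation as in `BanFunctor.sum_coface_coface`. A degree of `P ⊗̂ Y` involves
several degrees of `Y`, so the induction needs functors of graded modules. -/
theorem GradedBanFunctor.sum_cofaceC_cofaceC (l : List ι) (F : GradedBanFunctor 𝒞 A)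
    (x : ∀ l, F.obj (tensorListC P l).X) :
    ∑ j ∈ Finset.range l.length, ∑ i ∈ Finset.range (l.eraseIdx j).length,
      ((-1 : ℤ) ^ j * (-1 : ℤ) ^ i) • F.map (cofaceC P e l j)
        (F.map (cofaceC P e (l.eraseIdx j) i) (x ((l.eraseIdx j).eraseIdx i))) = 0 := by
  induction l generalizing F with
  | nil => rfl
  | cons k l ih =>
    refine sum_alternating_cancel (G := F.obj (tensorListC P (k :: l)).X) l.length _
      (fun j => (l.eraseIdx j).length) (fun j i => F.map (cofaceC P e (k :: l) j)
        (F.map (cofaceC P e ((k :: l).eraseIdx j) i) (x (((k :: l).eraseIdx j).eraseIdx i))))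
      rfl (fun _ => rfl) (fun j => ?_) (ih (F.compTot (P k)) fun l => x (k :: l))
    rw [F.map_comp, F.map_comp]
    exact DFunLike.congr_fun (congrArg F.map
      (funext fun q => (cofaceC_zero_naturality P e k (cofaceC P e l j) q).symm)) _

/-- The inserted element has degree `0`. Insertion at the head therefore fills only the components
of first degree `0`, where the sign in the total differential is `+1` and the term `d ⊗ id` receives
nothing. Insertions further on are handled by induction on the tail. -/
theorem cofaceC_d (l : List ι) (j q : ℕ) :
    (cofaceC P e l j q).comp ((tensorListC P (l.eraseIdx j)).d q) =
      ((tensorListC P l).d q).comp (cofaceC P e l j (q + 1)) := by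
  induction l generalizing j q with
  | nil => rfl
  | cons i l ih =>
    cases j with
    | zero =>
      refine BanMod.pi_hom_ext fun p => BanHom.ext fun x => ?_
      obtain ⟨⟨a, b⟩, h⟩ := p
      refine Eq.trans ?_ (BanComplex.tot_d_apply (P i) (tensorListC P l) q
        (cofaceC P e (i :: l) 0 (q + 1) x) a b h).symm
      cases a with
      | zero =>
        have h1 : ((P i).d 0).tensorMap (BanHom.id ((tensorListC P l).X b)) 0 = 0 := map_zero _
        refine Eq.trans ?_ (congrArg₂ (· + ·) h1.symm (one_smul ℤ _).symm)
        rw [zero_add]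
        refine Eq.trans ?_ (BanHom.tensorMap_tmul _ _ _ _).symm
        exact congrArg (((P i).X 0).tmul ((tensorListC P l).X b) (e i))
          ((tensorListC P l).castX_d _ _ x).symm
      | succ a =>
        have h1 : ((P i).d (a + 1)).tensorMap (BanHom.id ((tensorListC P l).X b)) 0 = 0 :=
          map_zero _
        have h2 : (BanHom.id ((P i).X (a + 1))).tensorMap ((tensorListC P l).d b) 0 = 0 :=
          map_zero _
        refine Eq.trans ?_ (congrArg₂ (· + ·) h1.symm (congrArg _ h2.symm))
        rw [smul_zero, add_zero]
        rfl
    | succ j =>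
      refine BanMod.pi_hom_ext fun p => BanHom.ext fun x => ?_
      obtain ⟨⟨a, b⟩, h⟩ := p
      refine Eq.trans ?_ (BanComplex.tot_d_apply (P i) (tensorListC P l) q
        (cofaceC P e (i :: l) (j + 1) (q + 1) x) a b h).symm
      refine (congrArg ((BanHom.id ((P i).X a)).tensorMap (cofaceC P e l j b))
        (BanComplex.tot_d_apply (P i) (tensorListC P (l.eraseIdx j)) q x a b h)).trans ?_
      rw [map_add, map_zsmul]
      refine congrArg₂ (· + ·) (DFunLike.congr_fun (?_ : BanHom.comp _ _ = BanHom.comp _ _) _)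
        (congrArg _ (DFunLike.congr_fun (?_ : BanHom.comp _ _ = BanHom.comp _ _) _))
      · rw [BanHom.tensorMap_comp, BanHom.tensorMap_comp]
        rfl
      · rw [BanHom.tensorMap_comp, BanHom.tensorMap_comp, ih]

theorem tensorListAug_cofaceC {P : ι → BanComplex 𝒞 A} {e : ∀ i, (P i).X 0}
    {M : ι → BanMod 𝒞 A} {v : ∀ i, M i} {ε : ∀ i, BanHom ((P i).X 0) (M i)}
    (hv : ∀ i, ε i (e i) = v i) (l : List ι) (j : ℕ) :
    (tensorListAug ε l).comp (cofaceC P e l j 0) =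
      (coface M v l j).comp (tensorListAug ε (l.eraseIdx j)) := by
  induction l generalizing j with
  | nil => rfl
  | cons i l ih =>
    cases j with
    | zero =>
      refine BanHom.ext fun x => (BanHom.tensorMap_tmul _ _ _ _).trans ?_
      rw [hv]
      rfl
    | succ j =>
      have h : ((ε i).tensorMap (tensorListAug ε l)).comp
            ((BanHom.id ((P i).X 0)).tensorMap (cofaceC P e l j 0)) =
          ((BanHom.id (M i)).tensorMap (coface M v l j)).comp
            ((ε i).tensorMap (tensorListAug ε (l.eraseIdx j))) := by
        rw [BanHom.tensorMap_comp, BanHom.tensorMap_comp, ih]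
        rfl
      exact BanHom.ext fun x => DFunLike.congr_fun h _

/-- The differential of the total derived Tate–Čech complex on families indexed by all lists and
degrees. -/
noncomputable def derivedCechFun (z : ∀ l q, (tensorListC P l).X q) (l : List ι) (q : ℕ) :
    (tensorListC P l).X q :=
  ∑ j ∈ Finset.range l.length, (-1 : ℤ) ^ j • cofaceC P e l j q (z (l.eraseIdx j) q) +
    (-1 : ℤ) ^ l.length • (tensorListC P l).d q (z l (q + 1))

variable {P e}

theorem derivedCechFun_congr {z z' : ∀ l q, (tensorListC P l).X q} {l : List ι} {q : ℕ}
    (h : ∀ j < l.length, z (l.eraseIdx j) q = z' (l.eraseIdx j) q)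
    (h' : z l (q + 1) = z' l (q + 1)) :
    derivedCechFun P e z l q = derivedCechFun P e z' l q := by
  rw [derivedCechFun, derivedCechFun, h']
  exact congrArg₂ _ (Finset.sum_congr rfl fun j hj => by rw [h j (Finset.mem_range.1 hj)]) rfl

/-- Double insertions cancel among themselves and `d d = 0` in each column; the mixed terms are
left. -/
theorem derivedCechFun_derivedCechFun (z : ∀ l q, (tensorListC P l).X q) (l : List ι) (q : ℕ) :
    derivedCechFun P e (derivedCechFun P e z) l q = 0 := by
  have h := GradedBanFunctor.sum_cofaceC_cofaceC P e l
    { obj := fun Y => Y q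
      map := fun f => f q
      map_comp := fun _ _ _ => rfl } fun l => z l q
  simp only [mul_smul] at h
  have hd : (tensorListC P l).d q ((tensorListC P l).d (q + 1) (z l (q + 1 + 1))) = 0 :=
    DFunLike.congr_fun ((tensorListC P l).d_comp_d q) _
  simp only [derivedCechFun, map_add, map_sum, map_zsmul, Finset.smul_sum, smul_add,
    Finset.sum_add_distrib, hd, smul_zero, add_zero]
  rw [h, zero_add, ← Finset.sum_add_distrib]
  refine Finset.sum_eq_zero fun j hj => ?_
  have hlen : l.length = (l.eraseIdx j).length + 1 := by
    have := Finset.mem_range.1 hj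
    rw [List.length_eraseIdx_of_lt this]
    omega
  have hc : cofaceC P e l j q ((tensorListC P (l.eraseIdx j)).d q (z (l.eraseIdx j) (q + 1))) =
      (tensorListC P l).d q (cofaceC P e l j (q + 1) (z (l.eraseIdx j) (q + 1))) :=
    DFunLike.congr_fun (cofaceC_d P e l j q) _
  -- Erasing an entry lowers the length by one, so the two mixed terms carry opposite column signs.
  rw [hc, smul_comm ((-1 : ℤ) ^ l.length), ← smul_add, ← add_smul, hlen, pow_succ, mul_neg_one,
    add_neg_cancel, zero_smul, smul_zero]

/-- The augmentation kills the column differential and commutes with insertions, so it maps the row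
`q = 0` of the derived complex to the ordinary Čech complex compatibly with the differentials. -/
theorem tensorListAug_derivedCechFun {M : ι → BanMod 𝒞 A} {v : ∀ i, M i}
    {ε : ∀ i, BanHom ((P i).X 0) (M i)} (hv : ∀ i, ε i (e i) = v i)
    (c : ∀ i, (P i).Contraction (ε i)) (z : ∀ l q, (tensorListC P l).X q) (l : List ι) :
    tensorListAug ε l (derivedCechFun P e z l 0) =
      cechFun M v (fun l => tensorListAug ε l (z l 0)) l := by
  rw [derivedCechFun, map_add, map_zsmul, (tensorListContraction c l).aug_d_apply, smul_zero,
    add_zero, map_sum, cechFun]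
  refine Finset.sum_congr rfl fun j _ => ?_
  rw [map_zsmul]
  exact congrArg _ (DFunLike.congr_fun (tensorListAug_cofaceC hv l j) _)

end Coface

/-! ### Acyclicity of the total derived Tate–Čech complex -/

section DerivedAcyclic

variable {𝒞 : BanachKind} {A : Type u} [BanachRing A] [IsOfKind 𝒞 A] {m : ℕ}
  {P : Fin m → BanComplex 𝒞 A} {e : ∀ i, (P i).X 0}

open Classical in
/-- The extension by zero of a derived Tate–Čech cochain to all lists and degrees. -/
noncomputable def derivedCechExt {n : ℤ} (x : derivedCechX P n) (l : List (Fin m)) (q : ℕ) :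
    (tensorListC P l).X q :=
  if h : l.Pairwise (· < ·) ∧ (l.length : ℤ) - q = n then
    (x : ∀ y : DerivedCechIdx m n, (tensorListC P y.1.1).X y.1.2) ⟨(l, q), h⟩ else 0

variable {n : ℤ}

theorem derivedCechExt_apply (x : derivedCechX P n) (y : DerivedCechIdx m n) :
    derivedCechExt x y.1.1 y.1.2 =
      (x : ∀ y : DerivedCechIdx m n, (tensorListC P y.1.1).X y.1.2) y :=
  dif_pos y.2

theorem derivedCechExt_of_not (x : derivedCechX P n) {l : List (Fin m)} {q : ℕ}
    (h : ¬ (l.Pairwise (· < ·) ∧ (l.length : ℤ) - q = n)) : derivedCechExt x l q = 0 :=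
  dif_neg h

theorem derivedCechX_ext {x y : derivedCechX P n}
    (h : ∀ l q, derivedCechExt x l q = derivedCechExt y l q) : x = y :=
  funext fun i : DerivedCechIdx m n =>
    (derivedCechExt_apply x i).symm.trans ((h _ _).trans (derivedCechExt_apply y i))

theorem derivedCechExt_zero (l : List (Fin m)) (q : ℕ) :
    derivedCechExt (0 : derivedCechX P n) l q = 0 := by
  by_cases h : l.Pairwise (· < ·) ∧ (l.length : ℤ) - q = n
  · exact derivedCechExt_apply 0 ⟨(l, q), h⟩
  · exact derivedCechExt_of_not 0 h

theorem derivedCechExt_sub (x y : derivedCechX P n) (l : List (Fin m)) (q : ℕ) :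
    derivedCechExt (x - y) l q = derivedCechExt x l q - derivedCechExt y l q := by
  by_cases h : l.Pairwise (· < ·) ∧ (l.length : ℤ) - q = n
  · have hx := derivedCechExt_apply x ⟨(l, q), h⟩
    have hy := derivedCechExt_apply y ⟨(l, q), h⟩
    exact (derivedCechExt_apply (x - y) ⟨(l, q), h⟩).trans (congrArg₂ (· - ·) hx hy).symm
  · rw [derivedCechExt_of_not _ h, derivedCechExt_of_not _ h, derivedCechExt_of_not _ h, sub_zero]

theorem derivedCechExt_derivedCechD (x : derivedCechX P n) {l : List (Fin m)} {q : ℕ}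
    (hl : l.Pairwise (· < ·)) (hq : (l.length : ℤ) - q = n + 1) :
    derivedCechExt (derivedCechD P e n x) l q = derivedCechFun P e (derivedCechExt x) l q := by
  refine (derivedCechExt_apply (derivedCechD P e n x) ⟨(l, q), hl, hq⟩).trans ?_
  refine (BanHom.add_apply _ _ x).trans ?_
  refine congrArg₂ (· + ·) ?_ ?_
  · refine (BanHom.sum_apply _ _ _).trans ?_
    rw [Finset.sum_range]
    refine Finset.sum_congr rfl fun j _ => ?_
    refine (BanHom.zsmul_apply _ _ _).trans ?_
    refine congrArg _ (congrArg (cofaceC P e l j q) ?_)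
    exact (derivedCechExt_apply x ⟨(l.eraseIdx j, q),
      hl.sublist (List.eraseIdx_sublist _ _), by
        have h2 : (j : ℕ) < l.length := j.2
        simp only [List.length_eraseIdx_of_lt h2]
        omega⟩).symm
  · refine (BanHom.zsmul_apply _ _ _).trans ?_
    refine congrArg _ (congrArg ((tensorListC P l).d q) ?_)
    exact (derivedCechExt_apply x ⟨(l, q + 1), hl, by push_cast; omega⟩).symm

theorem derivedCechD_derivedCechD (x : derivedCechX P n) :
    derivedCechD P e (n + 1) (derivedCechD P e n x) = 0 := by
  refine derivedCechX_ext fun l q => ?_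
  rw [derivedCechExt_zero]
  by_cases h : l.Pairwise (· < ·) ∧ (l.length : ℤ) - q = n + 1 + 1
  · obtain ⟨hl, hq⟩ := h
    rw [derivedCechExt_derivedCechD _ hl hq,
      ← derivedCechFun_derivedCechFun (e := e) (derivedCechExt x) l q]
    refine derivedCechFun_congr (fun j hj => ?_) ?_
    · refine derivedCechExt_derivedCechD x (hl.sublist (List.eraseIdx_sublist _ _)) ?_
      rw [List.length_eraseIdx_of_lt hj]
      omega
    · refine derivedCechExt_derivedCechD x hl ?_
      push_cast
      omega
  · exact derivedCechExt_of_not _ h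

variable {M : Fin m → BanMod 𝒞 A} {v : ∀ i, M i} {ε : ∀ i, BanHom ((P i).X 0) (M i)}

open Classical in
/-- The lift of the contracting operator of the Tate–Čech complex to the derived one. -/
noncomputable def CechSplitting.derivedOperator (S : CechSplitting M v)
    (c : ∀ i, (P i).Contraction (ε i)) (n : ℤ) :
    BanHom (derivedCechX P (n + 1)) (derivedCechX P n) :=
  BanMod.piLift fun y : DerivedCechIdx m n =>
    match y with
    | ⟨(l, 0), hl⟩ => (tensorListContraction c l).σ.comp (∑ i,
        if h : (i :: l).Pairwise (· < ·) then
          (BanMod.contract (S.φ i) (tensorList M l)).comp ((tensorListAug ε (i :: l)).comp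
            (BanMod.proj (fun y : DerivedCechIdx m (n + 1) => (tensorListC P y.1.1).X y.1.2)
              ⟨(i :: l, 0), h, by
                have := hl.2
                simp only [List.length_cons] at this ⊢
                push_cast at this ⊢
                omega⟩))
        else 0)
    -- The lift only has to correct the augmentation, which sees the row `q = 0` alone.
    | ⟨(_, _ + 1), _⟩ => 0

theorem CechSplitting.derivedOperator_apply (S : CechSplitting M v)
    (c : ∀ i, (P i).Contraction (ε i)) (x : derivedCechX P (n + 1)) {l : List (Fin m)}
    (hl : l.Pairwise (· < ·)) (hn : (l.length : ℤ) - (0 : ℕ) = n) :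
    derivedCechExt (S.derivedOperator c n x) l 0 = (tensorListContraction c l).σ
      (S.homotopy (fun l => tensorListAug ε l (derivedCechExt x l 0)) l) := by
  refine (derivedCechExt_apply (S.derivedOperator c n x) ⟨(l, 0), hl, hn⟩).trans ?_
  refine congrArg (tensorListContraction c l).σ ?_
  refine (BanHom.sum_apply _ _ _).trans (Finset.sum_congr rfl fun i _ => ?_)
  rw [part]
  split_ifs with h
  · exact congrArg _ (congrArg (tensorListAug ε (i :: l))
      (derivedCechExt_apply x ⟨(i :: l, 0), h, by
        simp only [List.length_cons]
        push_cast at hn ⊢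
        omega⟩).symm)
  · rfl

theorem cechFun_tensorListAug_eq_zero (hv : ∀ i, ε i (e i) = v i)
    (c : ∀ i, (P i).Contraction (ε i)) {x : derivedCechX P n} (hx : derivedCechD P e n x = 0)
    {l : List (Fin m)} (hl : l.Pairwise (· < ·)) (hn : (l.length : ℤ) = n + 1) :
    cechFun M v (fun l => tensorListAug ε l (derivedCechExt x l 0)) l = 0 := by
  rw [← tensorListAug_derivedCechFun hv c, ← derivedCechExt_derivedCechD x hl (by simpa using hn),
    hx, derivedCechExt_zero, map_zero]

/-- The augmentation of `x` is an ordinary Čech cocycle, and the homotopy gives a primitive of it.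
Since `ε σ = id`, the lifted primitive augments to that one, so subtracting its differential leaves
augmentation zero. -/
theorem CechSplitting.tensorListAug_derivedOperator (S : CechSplitting M v)
    (c : ∀ i, (P i).Contraction (ε i)) (hv : ∀ i, ε i (e i) = v i)
    {x : derivedCechX P (n + 1)} (hx : derivedCechD P e (n + 1) x = 0) (l : List (Fin m)) :
    tensorListAug ε l (derivedCechExt (x - derivedCechD P e n (S.derivedOperator c n x)) l 0) =
      0 := by
  by_cases h : l.Pairwise (· < ·) ∧ (l.length : ℤ) - (0 : ℕ) = n + 1
  · obtain ⟨hl, hn⟩ := h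
    have hn' : (l.length : ℤ) = n + 1 := by simpa using hn
    rw [derivedCechExt_sub, map_sub, derivedCechExt_derivedCechD _ hl hn,
      tensorListAug_derivedCechFun hv c, sub_eq_zero]
    refine (S.cechFun_homotopy _ hl fun i hi => cechFun_tensorListAug_eq_zero hv c hx hi (by
      rw [List.length_cons]
      push_cast
      omega)).symm.trans (cechFun_congr fun j hj => ?_)
    rw [S.derivedOperator_apply c x (hl.sublist (List.eraseIdx_sublist _ _)) (by
      rw [List.length_eraseIdx_of_lt hj]
      push_cast
      omega), (tensorListContraction c _).aug_σ_apply]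
  · rw [derivedCechExt_of_not _ h, map_zero]

/-- The homotopy of the columns of the derived Tate–Čech complex. -/
noncomputable def columnHomotopy (c : ∀ i, (P i).Contraction (ε i)) (n : ℤ) :
    BanHom (derivedCechX P (n + 1)) (derivedCechX P n) :=
  BanMod.piLift fun y : DerivedCechIdx m n =>
    match y with
    | ⟨(_, 0), _⟩ => 0
    -- The sign matches the one on the column differential, so that their product is `1`.
    | ⟨(l, q + 1), hl⟩ => (-1 : ℤ) ^ l.length • ((tensorListContraction c l).s q).comp
        (BanMod.proj (fun y : DerivedCechIdx m (n + 1) => (tensorListC P y.1.1).X y.1.2)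
          ⟨(l, q), hl.1, by
            have := hl.2
            simp only at this ⊢
            push_cast at this
            omega⟩)

theorem columnHomotopy_zero (c : ∀ i, (P i).Contraction (ε i)) (x : derivedCechX P (n + 1))
    (l : List (Fin m)) : derivedCechExt (columnHomotopy c n x) l 0 = 0 := by
  by_cases h : l.Pairwise (· < ·) ∧ (l.length : ℤ) - (0 : ℕ) = n
  · exact derivedCechExt_apply (columnHomotopy c n x) ⟨(l, 0), h⟩
  · exact derivedCechExt_of_not _ h

theorem columnHomotopy_succ (c : ∀ i, (P i).Contraction (ε i)) (x : derivedCechX P (n + 1))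
    (l : List (Fin m)) (q : ℕ) : derivedCechExt (columnHomotopy c n x) l (q + 1) =
      (-1 : ℤ) ^ l.length • (tensorListContraction c l).s q (derivedCechExt x l q) := by
  by_cases h : l.Pairwise (· < ·) ∧ (l.length : ℤ) - (q + 1 : ℕ) = n
  · refine (derivedCechExt_apply (columnHomotopy c n x) ⟨(l, q + 1), h⟩).trans ?_
    refine (BanHom.zsmul_apply _ _ _).trans ?_
    refine congrArg _ (congrArg ((tensorListContraction c l).s q) ?_)
    exact (derivedCechExt_apply x ⟨(l, q), h.1, by
      have := h.2
      push_cast at this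
      simp only
      omega⟩).symm
  · have h' : ¬ (l.Pairwise (· < ·) ∧ (l.length : ℤ) - q = n + 1) := by
      rintro ⟨h1, h2⟩
      refine h ⟨h1, ?_⟩
      push_cast
      omega
    rw [derivedCechExt_of_not _ h, derivedCechExt_of_not _ h', map_zero, smul_zero]

/-- A cocycle which maps to zero in the Tate–Čech complex and lives in Čech degrees `≥ k`. -/
structure IsReducedCocycle (e : ∀ i, (P i).X 0) (ε : ∀ i, BanHom ((P i).X 0) (M i)) (k : ℕ)
    (x : derivedCechX P n) : Prop where
  cocycle : derivedCechD P e n x = 0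
  aug_eq_zero : ∀ l, tensorListAug ε l (derivedCechExt x l 0) = 0
  ext_eq_zero : ∀ l q, l.length < k → derivedCechExt x l q = 0

/-- At a list of length at most `k` all insertions come from shorter lists, where `x` vanishes.
There the cocycle condition makes `x` a cycle of the column, with zero augmentation at `q = 0`, so
the column contraction recovers `x` and the difference vanishes. The augmentation stays zero because
the column homotopy has no component at `q = 0`. -/
theorem IsReducedCocycle.sub_columnHomotopy (c : ∀ i, (P i).Contraction (ε i))
    (hv : ∀ i, ε i (e i) = v i) {k : ℕ} {x : derivedCechX P (n + 1)}
    (hx : IsReducedCocycle e ε k x) :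
    IsReducedCocycle e ε (k + 1) (x - derivedCechD P e n (columnHomotopy c n x)) := by
  refine ⟨by rw [map_sub, hx.cocycle, derivedCechD_derivedCechD, sub_zero], fun l => ?_,
    fun l q hk => ?_⟩
  · by_cases h : l.Pairwise (· < ·) ∧ (l.length : ℤ) - (0 : ℕ) = n + 1
    · rw [derivedCechExt_sub, map_sub, hx.aug_eq_zero, derivedCechExt_derivedCechD _ h.1 h.2,
        tensorListAug_derivedCechFun hv c, zero_sub, neg_eq_zero]
      refine Finset.sum_eq_zero fun j _ => ?_
      simp only [columnHomotopy_zero, map_zero, smul_zero]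
    · rw [derivedCechExt_of_not _ h, map_zero]
  · by_cases h : l.Pairwise (· < ·) ∧ (l.length : ℤ) - q = n + 1
    · obtain ⟨hl, hn⟩ := h
      have hlt : ∀ j < l.length, (l.eraseIdx j).length < k := fun j hj => by
        rw [List.length_eraseIdx_of_lt hj]
        omega
      have hsgn : (-1 : ℤ) ^ l.length * (-1 : ℤ) ^ l.length = 1 := by
        rw [← mul_pow, neg_one_mul, neg_neg, one_pow]
      rw [derivedCechExt_sub, derivedCechExt_derivedCechD _ hl hn, derivedCechFun,
        Finset.sum_eq_zero, zero_add, columnHomotopy_succ, map_zsmul, smul_smul, hsgn, one_smul,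
        sub_eq_zero]
      · cases q with
        | zero =>
          have h0 := (tensorListContraction c l).zero_apply (derivedCechExt x l 0)
          rw [hx.aug_eq_zero, map_zero, zero_add] at h0
          exact h0.symm
        | succ q =>
          have h1 := (tensorListContraction c l).succ_apply q (derivedCechExt x l (q + 1))
          have h2 : derivedCechFun P e (derivedCechExt x) l q = 0 := by
            rw [← derivedCechExt_derivedCechD x hl (by push_cast at hn; omega), hx.cocycle,
              derivedCechExt_zero]
          rw [derivedCechFun, Finset.sum_eq_zero, zero_add] at h2
          · have h3 := congrArg (fun t => (-1 : ℤ) ^ l.length • t) h2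
            simp only [smul_smul, hsgn, one_smul, smul_zero] at h3
            rw [h3, map_zero, zero_add] at h1
            exact h1.symm
          · intro j hj
            rw [hx.ext_eq_zero _ _ (hlt j (Finset.mem_range.1 hj)), map_zero, smul_zero]
      · intro j hj
        have h4 : derivedCechExt (columnHomotopy c n x) (l.eraseIdx j) q = 0 := by
          cases q with
          | zero => exact columnHomotopy_zero c x _
          | succ q =>
            rw [columnHomotopy_succ, hx.ext_eq_zero _ _ (hlt j (Finset.mem_range.1 hj)),
              map_zero, smul_zero]
        rw [h4, map_zero, smul_zero]
    · exact derivedCechExt_of_not _ h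

/-- A strictly increasing list in `Fin m` has at most `m` entries, so no Čech degree is left. -/
theorem IsReducedCocycle.eq_zero {x : derivedCechX P n} (hx : IsReducedCocycle e ε (m + 1) x) :
    x = 0 := by
  refine derivedCechX_ext fun l q => ?_
  rw [derivedCechExt_zero]
  by_cases h : l.Pairwise (· < ·)
  · refine hx.ext_eq_zero l q ?_
    have hn : l.Nodup := h.imp fun h => ne_of_lt h
    have := hn.length_le_card
    rw [Fintype.card_fin] at this
    omega
  · exact derivedCechExt_of_not _ fun h' => h h'.1

/-- The column correction is iterated `k` times. `T` is chosen before `x`, so one bound serves all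
cocycles, as strictness demands. -/
theorem exists_operator_isReducedCocycle (c : ∀ i, (P i).Contraction (ε i))
    (hv : ∀ i, ε i (e i) = v i) (n : ℤ) (k : ℕ) :
    ∃ T : BanHom (derivedCechX P (n + 1)) (derivedCechX P n), ∀ x,
      IsReducedCocycle e ε 0 x → IsReducedCocycle e ε k (x - derivedCechD P e n (T x)) := by
  induction k with
  | zero => exact ⟨0, fun x hx => by rwa [BanHom.zero_apply, map_zero, sub_zero]⟩
  | succ k ih =>
    obtain ⟨T, hT⟩ := ih
    -- The column homotopy is applied to the remainder `x - d (T x)` left by the previous stages.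
    refine ⟨T + (columnHomotopy c n).comp (BanHom.id _ - (derivedCechD P e n).comp T),
      fun x hx => ?_⟩
    have h := (hT x hx).sub_columnHomotopy c hv
    rw [BanHom.add_apply, map_add, BanHom.comp_apply, BanHom.sub_apply, BanHom.id_apply,
      BanHom.comp_apply, ← sub_sub]
    exact h

theorem CechSplitting.strictExactAt_derivedCechD (S : CechSplitting M v)
    (c : ∀ i, (P i).Contraction (ε i)) (hv : ∀ i, ε i (e i) = v i) (n : ℤ) :
    StrictExactAt (derivedCechD P e n) (derivedCechD P e (n + 1)) := by
  obtain ⟨T, hT⟩ := exists_operator_isReducedCocycle c hv n (m + 1)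
  -- The primitive has two parts: the lifted Čech operator, which makes the augmentation vanish, and
  -- `T` applied to the remainder. After `m + 1` column corrections nothing remains.
  refine strictExactAt_of_operator derivedCechD_derivedCechD (S.derivedOperator c n +
    T.comp (BanHom.id _ - (derivedCechD P e n).comp (S.derivedOperator c n))) fun x hx => ?_
  have h := (hT (x - derivedCechD P e n (S.derivedOperator c n x))
    ⟨by rw [map_sub, hx, derivedCechD_derivedCechD, sub_zero],
      S.tensorListAug_derivedOperator c hv hx, fun l q h => absurd h (Nat.not_lt_zero _)⟩).eq_zero
  rw [sub_sub, sub_eq_zero] at h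
  rw [BanHom.add_apply, map_add, BanHom.comp_apply, BanHom.sub_apply, BanHom.id_apply,
    BanHom.comp_apply]
  exact h.symm

theorem CechSplitting.derivedTateAcyclic {B : Fin m → BanAlg 𝒞 A}
    (S : CechSplitting (fun i => (B i).toMod) (fun i => (B i).unitElt))
    (hp : ∀ i, (B i).toMod.IsProjective) (hu : ∀ i, Nonempty (B i).UnitalResolution) :
    DerivedTateAcyclic B := by
  refine ⟨hu, fun P n => ?_⟩
  exact S.strictExactAt_derivedCechD (ε := fun i => (P i).aug)
    (fun i => ((P i).toBanResolution.nonempty_contraction (hp i)).some) (fun i => (P i).aug_one) n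

end DerivedAcyclic

/-! ### Covers by quotients by idempotents -/

section Cover

variable {𝒞 : BanachKind} {A : Type u} [BanachRing A] [IsOfKind 𝒞 A] {m : ℕ}

/-- The sum telescopes: each term is the difference of the products over `k < i` and over `k ≤ i`.
-/
theorem sum_prod_lt_mul_one_sub {R : Type*} [CommRing R] {m : ℕ} (e : Fin m → R) :
    ∑ i, (∏ k ∈ Finset.univ.filter (· < i), e k) * (1 - e i) = 1 - ∏ i, e i := by
  induction m with
  | zero => simp
  | succ m ih =>
    have h1 : Finset.univ.filter (fun k : Fin (m + 1) => k < Fin.last m) =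
        Finset.univ.map Fin.castSuccEmb := by
      ext k
      simp [Fin.lt_last_iff_ne_last, Fin.exists_castSucc_eq]
    have h2 : ∀ i : Fin m, Finset.univ.filter (fun k : Fin (m + 1) => k < i.castSucc) =
        (Finset.univ.filter (· < i)).map Fin.castSuccEmb := by
      intro i
      ext k
      refine Fin.lastCases ?_ (fun k => ?_) k
      · simp [Fin.le_last]
      · simp
    rw [Fin.sum_univ_castSucc, Fin.prod_univ_castSucc, h1]
    simp only [h2, Finset.prod_map, Fin.coe_castSuccEmb]
    rw [ih fun i => e i.castSucc]
    ring

/-- Take `φ i = a i • π i` with `a i` the product of the earlier `e k`. For `k < i` the factor `e k`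
makes the values of `φ i` act by zero on `B k`, and the weights `a i * (1 - e i)` telescope to `1 -
∏ e i = 1`. -/
theorem nonempty_cechSplitting {B : Fin m → BanAlg 𝒞 A} {e : Fin m → A}
    (hB : ∀ i, (B i).IsIdempotentQuotient (e i))
    (h0 : ∏ i, e i = 0) :
    Nonempty (CechSplitting (fun i => (B i).toMod) (fun i => (B i).unitElt)) := by
  choose π hπ using fun i => (hB i).exists_section
  let a : Fin m → A := fun i => ∏ k ∈ Finset.univ.filter (· < i), e k
  have hφ : ∀ i (t : A), BanHom.scalar (BanMod.regular 𝒞 A) (a i) (π i (t • (B i).unitElt)) =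
      (a i * (t * (1 - e i)) : A) := fun i t => by
    rw [map_smul, hπ]
    rfl
  refine ⟨{
    φ := fun i => (BanHom.scalar (BanMod.regular 𝒞 A) (a i)).comp (π i)
    weight := fun i => a i * (1 - e i)
    φ_v := fun i => by
      rw [BanHom.comp_apply, hπ]
      rfl
    φ_smul_v := fun i b => ?_
    φ_smul_of_lt := fun i k hk b c => ?_
    sum_weight := by rw [sum_prod_lt_mul_one_sub, h0, sub_zero] }⟩
  · obtain ⟨t, rfl⟩ := (hB i).exists_smul_unitElt b
    rw [BanHom.comp_apply, hφ]
    change (a i * (t * (1 - e i))) • _ = _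
    rw [smul_smul]
    congr 1
    ring
  · obtain ⟨t, rfl⟩ := (hB i).exists_smul_unitElt b
    obtain ⟨s, hs⟩ : e k ∣ a i := Finset.dvd_prod_of_mem _ (by simpa using hk)
    rw [BanHom.comp_apply, hφ]
    change (a i * (t * (1 - e i))) • c = 0
    rw [hs, mul_assoc, mul_smul, (hB k).smul_eq_zero]

/-- A set of quotients of `A` by idempotents with product zero, indexed by a finite set, is both a
derived and a non-derived cover. -/
theorem isCover_of_prod_eq_zero (s : Finset A) (hs : ∀ e ∈ s, IsIdempotentElem e)
    (h0 : ∏ e ∈ s, e = 0) (T : Set (BanAlg 𝒞 A))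
    (hT : ∀ B, B ∈ T ↔ ∃ e ∈ s, ∃ h : IsClosed ((Ideal.span {e} : Ideal A) : Set A),
      B = BanAlg.quotient 𝒞 (Ideal.span {e}) h) :
    IsDerivedCover T ∧ IsNonDerivedCover T := by
  have hq : ∀ B ∈ T, ∃ e, B.IsIdempotentQuotient e := fun B hB => by
    obtain ⟨e, he, h, rfl⟩ := (hT B).1 hB
    exact ⟨e, BanAlg.quotient_isIdempotentQuotient (hs e he) h⟩
  let f : Fin s.card → A := fun i => s.equivFin.symm i
  have hf : ∀ i, IsIdempotentElem (f i) := fun i => hs _ (s.equivFin.symm i).2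
  let B : Fin s.card → BanAlg 𝒞 A := fun i =>
    BanAlg.quotient 𝒞 (Ideal.span {f i}) (isClosed_span_idempotent (hf i))
  have hB : ∀ i, (B i).IsIdempotentQuotient (f i) := fun i =>
    BanAlg.quotient_isIdempotentQuotient (hf i) _
  -- The algebra determines the ideal, and the ideal determines the idempotent, so the enumeration
  -- of `s` yields no repeated algebra.
  have hinj : Function.Injective B := fun i j h =>
    s.equivFin.symm.injective (Subtype.ext
      ((hf i).span_singleton_injective (hf j) (BanAlg.quotient_injective h)))
  have hmem : ∀ i, B i ∈ T := fun i => (hT _).2 ⟨f i, (s.equivFin.symm i).2, _, rfl⟩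
  have hprod : ∏ i, f i = 0 := by
    rw [← h0, ← Finset.prod_coe_sort s fun e => e]
    exact Equiv.prod_comp s.equivFin.symm fun e : s => (e : A)
  obtain ⟨S⟩ := nonempty_cechSplitting hB hprod
  exact ⟨⟨fun B hB => (hq B hB).choose_spec.isHomotopyEpi, s.card, B, hinj, hmem,
      S.derivedTateAcyclic (fun i => (hB i).isProjective)
        fun i => (hB i).nonempty_unitalResolution⟩,
    fun B hB => (hq B hB).choose_spec.isEpi, s.card, B, hinj, hmem, S.tateAcyclic⟩

/-- Expanding the product, every term with two distinct factors vanishes by orthogonality. -/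
theorem prod_one_sub_of_orthogonal {R : Type*} [CommRing R] (s : Finset R)
    (h : ∀ e ∈ s, ∀ f ∈ s, e ≠ f → e * f = 0) : ∏ e ∈ s, (1 - e) = 1 - ∑ e ∈ s, e := by
  classical
  induction s using Finset.induction_on with
  | empty => simp
  | insert a s ha ih =>
    rw [Finset.prod_insert ha, Finset.sum_insert ha,
      ih fun e he f hf => h e (Finset.mem_insert_of_mem he) f (Finset.mem_insert_of_mem hf)]
    have h0 : a * ∑ e ∈ s, e = 0 := by
      rw [Finset.mul_sum]
      exact Finset.sum_eq_zero fun e he => h a (Finset.mem_insert_self a s) e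
        (Finset.mem_insert_of_mem he) fun hae => ha (hae ▸ he)
    linear_combination h0

/-- Two distinct members already multiply to zero. An empty family forces `1 = 0`, and a single
member must equal `1`, which is the excluded case. -/
theorem prod_eq_zero_of_orthogonal {R : Type*} [CommRing R] (s : Finset R)
    (h : ∀ e ∈ s, ∀ f ∈ s, e ≠ f → e * f = 0) (hsum : ∑ e ∈ s, e = 1)
    (hs : s ≠ {1} ∨ Subsingleton R) : ∏ e ∈ s, e = 0 := by
  classical
  rcases hs with hs | hs
  · rcases s.eq_empty_or_nonempty with rfl | ⟨a, ha⟩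
    · rw [Finset.prod_empty, ← hsum, Finset.sum_empty]
    · by_cases hb : ∃ b ∈ s, b ≠ a
      · obtain ⟨b, hb, hba⟩ := hb
        rw [← Finset.mul_prod_erase s _ ha,
          ← Finset.mul_prod_erase _ _ (Finset.mem_erase.2 ⟨hba, hb⟩), ← mul_assoc,
          h a ha b hb hba.symm, zero_mul]
      · push Not at hb
        have hsa : s = {a} := Finset.eq_singleton_iff_unique_mem.2 ⟨ha, hb⟩
        rw [hsa, Finset.sum_singleton] at hsum
        exact absurd (hsum ▸ hsa) hs
  · exact Subsingleton.elim _ _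

end Cover

theorem mainTheorem8 (𝒞 : BanachKind) (R : Type u) [BanachRing R] [IsOfKind 𝒞 R] :
    (∀ e : R, IsIdempotentElem e →
      ∃ h : IsClosed ((Ideal.span {e} : Ideal R) : Set R),
        (BanAlg.quotient 𝒞 (Ideal.span {e}) h).toMod.IsProjective ∧
        (BanAlg.quotient 𝒞 (Ideal.span {e}) h).IsHomotopyEpi) ∧
    (∀ E : Finset R, (∀ e ∈ E, IsIdempotentElem e) →
      (∀ e ∈ E, ∀ f ∈ E, e ≠ f → e * f = 0) → ∑ e ∈ E, e = 1 →
        ((E ≠ {1} ∨ Subsingleton R) →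
          IsDerivedCover {B : BanAlg 𝒞 R | ∃ e ∈ E,
            ∃ h : IsClosed ((Ideal.span {e} : Ideal R) : Set R),
              B = BanAlg.quotient 𝒞 (Ideal.span {e}) h} ∧
          IsNonDerivedCover {B : BanAlg 𝒞 R | ∃ e ∈ E,
            ∃ h : IsClosed ((Ideal.span {e} : Ideal R) : Set R),
              B = BanAlg.quotient 𝒞 (Ideal.span {e}) h}) ∧
        (IsDerivedCover {B : BanAlg 𝒞 R | ∃ e ∈ E,
            ∃ h : IsClosed ((Ideal.span {1 - e} : Ideal R) : Set R),
              B = BanAlg.quotient 𝒞 (Ideal.span {1 - e}) h} ∧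
          IsNonDerivedCover {B : BanAlg 𝒞 R | ∃ e ∈ E,
            ∃ h : IsClosed ((Ideal.span {1 - e} : Ideal R) : Set R),
              B = BanAlg.quotient 𝒞 (Ideal.span {1 - e}) h})) := by
  classical
  refine ⟨fun e he => ?_, fun E hE horth hsum => ⟨fun hne => ?_, ?_⟩⟩
  · have hB := BanAlg.quotient_isIdempotentQuotient (𝒞 := 𝒞) he (isClosed_span_idempotent he)
    exact ⟨_, hB.isProjective, hB.isHomotopyEpi⟩
  · exact isCover_of_prod_eq_zero E hE (prod_eq_zero_of_orthogonal E horth hsum hne) _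
      fun _ => Iff.rfl
  -- The product of the complements is `1 - ∑ e = 0` for every `E`, so no exception is needed here.
  · refine isCover_of_prod_eq_zero (E.image fun e => 1 - e) (fun f hf => ?_) ?_ _ fun B => ?_
    · obtain ⟨e, he, rfl⟩ := Finset.mem_image.1 hf
      exact (hE e he).one_sub
    · rw [Finset.prod_image fun a _ b _ h => sub_right_injective h,
        prod_one_sub_of_orthogonal E horth, hsum, sub_self]
    · simp only [Finset.exists_mem_image]
      exact Iff.rfl
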